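/- Let $N\ge 1$ be an integer and let $c,\sigma,\tau,\beta,\gamma,\alpha_1,\dots,\alpha_N$ be real constants with $$c>0,\quad \sigma>0,\quad \tau<c,\quad \beta\ge 0,\quad \gamma\ge 0,\quad \alpha_j>0\ (1\le j\le N),$$ and assume that $\gamma>0$ or $\beta=0$. For real-valued $f_1,\dots,f_N,g\in H^1(\mathbb R)$ put $$\mathsf K(f_1,\dots,f_N,g)=\int_{-\infty}^{\infty}\Big(\sum_{j=1}^N\big((f_j')^2+\sigma f_j^2\big)+\gamma (g')^2+(c-\tau)g^2\Big)\,dx,$$ $$F(f_1,\dots,f_N,g)=\tfrac13\beta g^3+\big(\alpha_1f_1^2+\dots+\alpha_Nf_N^2\big)g,$$ and, for $\lambda>0$, $$\mathcal A_\lambda=\Big\{(f_1,\dots,f_N,g)\in (H^1(\mathbb R))^{N+1}:\int_{-\infty}^{\infty}F(f_1,\dots,f_N,g)\,dx=\lambda\Big\}.$$ Then for every $\lambda>0$: (1) $\mathsf K$ attains its minimum on $\mathcal A_\lambda$. (2) For every minimizer $(\phi_1,\dots,\phi_N,\psi)$ of $\mathsf K$ on $\mathcal A_\lambda$ there is a constant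 $\kappa>0$ such that $(\Phi_1,\dots,\Phi_N,\Psi)=\kappa\,(\phi_1,\dots,\phi_N,\psi)$ (after modification on a null set) is a smooth, not identically zero, classical solution of $$\Phi_j''-\sigma\Phi_j=-\alpha_j\Phi_j\Psi\quad(1\le j\le N),\qquad \gamma\Psi''-(c-\tau)\Psi=-\tfrac12\beta\Psi^2-\tfrac12\sum_{j=1}^N\alpha_j\Phi_j^2,$$ all of whose components lie in $H^\infty(\mathbb R)=\bigcap_{k\ge 0}H^k(\mathbb R)$ and decay exponentially: each component $h$ satisfies $|h(x)|\le Ce^{-\delta|x|}$ for all $x\in\mathbb R$, with some $C,\delta>0$. Moreover, with $\omega=\sigma+c^2/4$, the functions $$u_j(x,t)=e^{i\omega t}e^{ic(x-ct)/2}\Phi_j(x-ct),\qquad v(x,t)=\Psi(x-ct)$$ form a smooth solution (a solitary wave) of the long wave-short wave interaction system $$i\partial_tu_j+\partial_x^2u_j=-\alpha_ju_jv\quad(1\le j\le N),\qquad \partial_tv+\partial_x\big(\gamma\partial_x^2v+\tau v+\tfrac{\beta}{2}v^2\big)=-\partial_x\Big(\sum_{j=1}^N\tfrac{\alpha_j}{2}|u_j|^2\Big).$$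 -/

import Mathlib

open scoped ContDiff
open MeasureTheory

noncomputable section

/-- `f'` is a weak derivative of `f` on the real line. Both functions are locally integrable, and
integration by parts holds against every smooth compactly supported test function. -/
structure IsWeakDeriv (f f' : ℝ → ℝ) : Prop where
  locallyIntegrable : LocallyIntegrable f
  locallyIntegrable_deriv : LocallyIntegrable f'
  integral_eq : ∀ φ : ℝ → ℝ, ContDiff ℝ ∞ φ → HasCompactSupport φ →
    ∫ x, f x * deriv φ x = - ∫ x, f' x * φ x

/-- Weak derivatives are unique up to null sets. -/
theorem IsWeakDeriv.ae_eq {f f₁ f₂ : ℝ → ℝ} (h₁ : IsWeakDeriv f f₁) (h₂ : IsWeakDeriv f f₂) :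
    f₁ =ᵐ[volume] f₂ := by
  refine ae_eq_of_integral_contDiff_smul_eq h₁.locallyIntegrable_deriv
    h₂.locallyIntegrable_deriv fun φ hφ hc => ?_
  have e₁ := h₁.integral_eq φ hφ hc
  have e₂ := h₂.integral_eq φ hφ hc
  simp only [smul_eq_mul, mul_comm (φ _)]
  linarith

/-- Membership in the (real-valued) Sobolev space `H^k` of the real line, for a natural number `k`:
`f` and its weak derivatives up to order `k` are square integrable. Functions are representatives
of their class modulo equality almost everywhere. -/
def MemH : ℕ → (ℝ → ℝ) → Prop
  | 0, f => MemLp f 2 volume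
  | k + 1, f => MemLp f 2 volume ∧ ∃ f' : ℝ → ℝ, IsWeakDeriv f f' ∧ MemH k f'

/-- Membership in `H^∞`, the intersection of all the spaces `H^k`. -/
def MemHInfty (f : ℝ → ℝ) : Prop := ∀ k : ℕ, MemH k f

open Classical in
/-- The weak derivative of `f` (a representative of it), and `0` if there is none. -/
def weakDeriv (f : ℝ → ℝ) : ℝ → ℝ :=
  if h : ∃ f' : ℝ → ℝ, IsWeakDeriv f f' then h.choose else 0

theorem IsWeakDeriv.weakDeriv_ae_eq {f f' : ℝ → ℝ} (h : IsWeakDeriv f f') :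
    weakDeriv f =ᵐ[volume] f' := by
  have hex : ∃ f' : ℝ → ℝ, IsWeakDeriv f f' := ⟨f', h⟩
  rw [weakDeriv, dif_pos hex]
  exact hex.choose_spec.ae_eq h

namespace LSI

variable {N : ℕ}

/-- The quadratic form `K` of the diagonal operator with entries `σ - ∂ₓₓ` (`N` times) and
`(c - τ) - γ ∂ₓₓ`, on `(H¹)^(N+1)`. -/
def energy (c σ τ γ : ℝ) (p : (Fin N → ℝ → ℝ) × (ℝ → ℝ)) : ℝ :=
  ∫ x, ((∑ j, (weakDeriv (p.1 j) x ^ 2 + σ * p.1 j x ^ 2)) +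
    (γ * weakDeriv p.2 x ^ 2 + (c - τ) * p.2 x ^ 2))

/-- The cubic density `F(f₁, …, f_N, g)`. -/
def density (β : ℝ) (α : Fin N → ℝ) (f : Fin N → ℝ) (g : ℝ) : ℝ :=
  1 / 3 * β * g ^ 3 + (∑ j, α j * f j ^ 2) * g

/-- The admissible set: tuples in `(H¹)^(N+1)` with `∫ F = lam`. -/
def admissible (β : ℝ) (α : Fin N → ℝ) (lam : ℝ) : Set ((Fin N → ℝ → ℝ) × (ℝ → ℝ)) :=
  {p | (∀ j, MemH 1 (p.1 j)) ∧ MemH 1 p.2 ∧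
    ∫ x, density β α (fun j => p.1 j x) (p.2 x) = lam}

/-- `p` minimizes `K` subject to the constraint `∫ F = lam`. -/
def IsMinimizer (c σ τ β γ : ℝ) (α : Fin N → ℝ) (lam : ℝ)
    (p : (Fin N → ℝ → ℝ) × (ℝ → ℝ)) : Prop :=
  p ∈ admissible β α lam ∧ IsMinOn (energy c σ τ γ) (admissible β α lam) p

/-- `(Φ₁, …, Φ_N, Ψ)` is a (smooth, classical) solution of the solitary-wave system. -/
structure SolvesODE (c σ τ β γ : ℝ) (α : Fin N → ℝ) (Φ : Fin N → ℝ → ℝ) (Ψ : ℝ → ℝ) : Prop where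
  smooth_short : ∀ j, ContDiff ℝ ∞ (Φ j)
  smooth_long : ContDiff ℝ ∞ Ψ
  short_eq : ∀ j x, iteratedDeriv 2 (Φ j) x - σ * Φ j x = - α j * Φ j x * Ψ x
  long_eq : ∀ x, γ * iteratedDeriv 2 Ψ x - (c - τ) * Ψ x =
    - (1 / 2) * β * Ψ x ^ 2 - 1 / 2 * ∑ j, α j * Φ j x ^ 2

/-- Pointwise exponential decay at infinity. -/
def ExpDecay (f : ℝ → ℝ) : Prop :=
  ∃ C > 0, ∃ δ > 0, ∀ x, |f x| ≤ C * Real.exp (-δ * |x|)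

/-- `(u₁, …, u_N, v)` (functions of `x` and `t`) is a smooth classical solution on `ℝ × ℝ` of the
long wave-short wave system with coefficients `α`, `b`, `γ` and nonlinearity `Q`:
`i ∂ₜ uⱼ + ∂ₓ² uⱼ = - αⱼ uⱼ v` and `∂ₜ v + ∂ₓ (γ ∂ₓ² v + Q(v)) = - ∂ₓ (∑ bⱼ |uⱼ|²)`. -/
structure SolvesLSI (γ : ℝ) (α b : Fin N → ℝ) (Q : Polynomial ℝ)
    (u : Fin N → ℝ → ℝ → ℂ) (v : ℝ → ℝ → ℝ) : Prop where
  smooth_short : ∀ j, ContDiff ℝ ∞ (fun q : ℝ × ℝ => u j q.1 q.2)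
  smooth_long : ContDiff ℝ ∞ (fun q : ℝ × ℝ => v q.1 q.2)
  short_eq : ∀ j x t, Complex.I * deriv (fun s => u j x s) t +
    iteratedDeriv 2 (fun y => u j y t) x = - (α j : ℂ) * u j x t * (v x t : ℂ)
  long_eq : ∀ x t, deriv (fun s => v x s) t +
    deriv (fun y => γ * iteratedDeriv 2 (fun z => v z t) y + Q.eval (v y t)) x =
      - deriv (fun y => ∑ j, b j * ‖u j y t‖ ^ 2) x

/-- The short-wave component `e^{i om t} e^{ic(x-ct)/2} Φ(x - ct)` of a travelling wave of speed `c`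
and frequency `om`. -/
def shortWave (c om : ℝ) (Φ : ℝ → ℝ) (x t : ℝ) : ℂ :=
  Complex.exp (Complex.I * om * t) * Complex.exp (Complex.I * c * (x - c * t) / 2) *
    (Φ (x - c * t) : ℂ)

/-- The long-wave component `Ψ(x - ct)` of a travelling wave. -/
def longWave (c : ℝ) (Ψ : ℝ → ℝ) (x t : ℝ) : ℝ := Ψ (x - c * t)

end LSI

end

/-! Write K for the energy and A for the integral of the cubic density. K is quadratic and A is
homogeneous of degree three, so with M the infimum of K on A = λ, scaling yields M³A(u)² ≤ λ²K(u)³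
for every tuple u (`cube_mul_sq_cubic_le`). This one inequality carries both the compactness
argument and the Euler-Lagrange equation.

Existence. Along a minimizing sequence the last component cannot tend to zero uniformly, because A ≤
C sup|g| K (`cubic_le_of_abs_fn_le`). After translating a peak to the origin and passing to a
subsequence, there is a nonzero weak limit V. Both functionals split in the limit
(`tendsto_quad_sub`, `tendsto_cubic_sub`): the remainder has energy tending to M - K(V) and
constraint value tending to λ - A(V). Put X = K(V)/M and s = A(V)/λ. The inequality for V and for
the remainder reads s² ≤ X³ and (1-s)² ≤ (1-X)³, which with 0 < X ≤ 1 forces s = X = 1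
(`eq_of_cube_le`). Thus V is a minimizer. If γ = 0, the energy does not bound the derivative of g.
Then β = 0 and A is linear in g, so g may first be replaced by the L²-optimal multiple of ∑ αⱼfⱼ²
(`exists_replacement`).

Solitary waves. At a minimizer the homogeneous inequality is an equality, so differentiating it
along a line gives the Euler-Lagrange equation with multiplier K/(3λ); scaling by κ = 2K/(3λ) turns
it into the weak form of the profile equations. One integration makes them classical, and a
differential inequality for squares gives exponential decay. Finally, the non-unital algebra
generated by the profiles and their first derivatives is closed under differentiation and consists
of exponentially decaying functions, which gives smoothness and membership in every Sobolev space at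
once. -/

/-! ### Weak derivatives on the line and absolutely continuous representatives. -/

section Primitive
open Set Filter Topology

/-- `f` is an indefinite integral of the locally integrable function `d`. -/
structure IsPrimitive (f d : ℝ → ℝ) : Prop where
  locallyIntegrable : LocallyIntegrable d
  integral_eq : ∀ x y, ∫ t in x..y, d t = f y - f x

theorem MeasureTheory.LocallyIntegrable.intervalIntegrable_real {d : ℝ → ℝ}
    (hd : LocallyIntegrable d) (a b : ℝ) : IntervalIntegrable d volume a b :=
  (hd.integrableOn_isCompact isCompact_uIcc).intervalIntegrable

theorem isPrimitive_integral {d : ℝ → ℝ} (hd : LocallyIntegrable d) (a : ℝ) :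
    IsPrimitive (fun x => ∫ t in a..x, d t) d :=
  ⟨hd, fun x y => (intervalIntegral.integral_interval_sub_left
    (hd.intervalIntegrable_real a y) (hd.intervalIntegrable_real a x)).symm⟩

theorem isPrimitive_deriv {f : ℝ → ℝ} (hf : ContDiff ℝ 1 f) : IsPrimitive f (deriv f) where
  locallyIntegrable := (hf.continuous_deriv le_rfl).locallyIntegrable
  integral_eq x y := intervalIntegral.integral_deriv_eq_sub
    (fun t _ => (hf.differentiable (by norm_num)).differentiableAt)
    ((hf.continuous_deriv le_rfl).intervalIntegrable x y)

namespace IsPrimitive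

variable {f d g e : ℝ → ℝ}

theorem eq_add (h : IsPrimitive f d) (a x : ℝ) : f x = f a + ∫ t in a..x, d t := by
  rw [h.integral_eq]; ring

theorem funext_eq (h : IsPrimitive f d) (a : ℝ) : f = fun x => f a + ∫ t in a..x, d t :=
  funext (h.eq_add a)

theorem ae_hasDerivAt (h : IsPrimitive f d) : ∀ᵐ x, HasDerivAt f (d x) x := by
  filter_upwards [LocallyIntegrable.ae_hasDerivAt_integral h.locallyIntegrable] with x hx
  rw [h.funext_eq 0]
  exact (hx 0).const_add _

theorem absolutelyContinuousOnInterval (h : IsPrimitive f d) (a b : ℝ) :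
    AbsolutelyContinuousOnInterval f a b := by
  have h1 := ((h.locallyIntegrable.intervalIntegrable_real
    a b).absolutelyContinuousOnInterval_intervalIntegral (c := a) (by simp))
  have h2 : AbsolutelyContinuousOnInterval (fun _ : ℝ => f a) a b :=
    ((LipschitzWith.const (f a)).lipschitzOnWith (s := uIcc a b)).absolutelyContinuousOnInterval
  rw [h.funext_eq a]
  exact h2.add h1

theorem continuous (h : IsPrimitive f d) : Continuous f := by
  rw [h.funext_eq 0]
  exact continuous_const.add (intervalIntegral.continuous_primitive
    (fun a b => h.locallyIntegrable.intervalIntegrable_real a b) 0)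

theorem hasDerivAt (h : IsPrimitive f d) (hd : Continuous d) (x : ℝ) : HasDerivAt f (d x) x := by
  rw [h.funext_eq 0]
  exact (intervalIntegral.integral_hasDerivAt_right (hd.intervalIntegrable _ _)
    (hd.stronglyMeasurableAtFilter _ _) hd.continuousAt).const_add _

theorem congr_ae (h : IsPrimitive f d) (hde : d =ᵐ[volume] e) : IsPrimitive f e where
  locallyIntegrable := by
    refine (locallyIntegrable_congr hde).1 h.locallyIntegrable
  integral_eq x y := by
    rw [← h.integral_eq]
    exact intervalIntegral.integral_congr_ae (hde.symm.mono fun _ ht _ => ht)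

theorem add (hf : IsPrimitive f d) (hg : IsPrimitive g e) : IsPrimitive (f + g) (d + e) where
  locallyIntegrable := hf.locallyIntegrable.add hg.locallyIntegrable
  integral_eq x y := by
    have := intervalIntegral.integral_add (hf.locallyIntegrable.intervalIntegrable_real x y)
      (hg.locallyIntegrable.intervalIntegrable_real x y)
    simp only [Pi.add_apply]
    rw [this, hf.integral_eq, hg.integral_eq]; ring

theorem const_smul (hf : IsPrimitive f d) (c : ℝ) : IsPrimitive (c • f) (c • d) where
  locallyIntegrable := hf.locallyIntegrable.smul c
  integral_eq x y := by
    simp only [Pi.smul_apply, smul_eq_mul, intervalIntegral.integral_const_mul, hf.integral_eq]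
    ring

theorem mul (hf : IsPrimitive f d) (hg : IsPrimitive g e) :
    IsPrimitive (fun x => f x * g x) (fun x => d x * g x + f x * e x) where
  locallyIntegrable :=
    (hf.locallyIntegrable.mul_continuous hg.continuous).add
      (hg.locallyIntegrable.continuous_mul hf.continuous)
  integral_eq x y := by
    rw [← (hf.absolutelyContinuousOnInterval x y).integral_deriv_mul_eq_sub
      (hg.absolutelyContinuousOnInterval x y)]
    refine intervalIntegral.integral_congr_ae ?_
    filter_upwards [hf.ae_hasDerivAt, hg.ae_hasDerivAt] with t h1 h2 _
    rw [h1.deriv, h2.deriv]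

theorem comp_add_const (h : IsPrimitive f d) (a : ℝ)
    (hd : LocallyIntegrable fun x => d (x + a)) :
    IsPrimitive (fun x => f (x + a)) (fun x => d (x + a)) where
  locallyIntegrable := hd
  integral_eq x y := by
    rw [intervalIntegral.integral_comp_add_right (fun t => d t), h.integral_eq]

/-- The product with a test function is again a primitive; over an interval containing the support
the boundary terms vanish. -/
theorem isWeakDeriv (h : IsPrimitive f d) : IsWeakDeriv f d where
  locallyIntegrable := h.continuous.locallyIntegrable
  locallyIntegrable_deriv := h.locallyIntegrable
  integral_eq φ hφ hc := by
    have hp := h.mul (isPrimitive_deriv (hφ.of_le (by exact_mod_cast le_top)))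
    have hφ' : Continuous (deriv φ) := hφ.continuous_deriv (by norm_num)
    have i1 : Integrable fun x => f x * deriv φ x :=
      (h.continuous.mul hφ').integrable_of_hasCompactSupport hc.deriv.mul_left
    have i2 : Integrable fun x => d x * φ x := by
      have := h.locallyIntegrable.integrable_smul_right_of_hasCompactSupport hφ.continuous hc
      simpa [mul_comm] using this
    have key : ∫ x, (d x * φ x + f x * deriv φ x) = 0 := by
      obtain ⟨R, hR⟩ := hc.isCompact.isBounded.subset_closedBall 0
      have hz : ∀ x, R < |x| → φ x = 0 := fun x hx => image_eq_zero_of_notMem_tsupport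
        fun hm => absurd (hx.trans_le (by simpa using hR hm)) (lt_irrefl _)
      have l1 := intervalIntegral_tendsto_integral (i2.add i1)
        (tendsto_neg_atTop_atBot (G := ℝ)) tendsto_id
      refine tendsto_nhds_unique l1 (tendsto_const_nhds.congr' ?_)
      filter_upwards [eventually_gt_atTop (max R 0)] with r hr
      have hr1 : R < r := (le_max_left _ _).trans_lt hr
      have hr0 : 0 < r := (le_max_right _ _).trans_lt hr
      have := hp.integral_eq (-r) r
      simp only [id]
      change 0 = ∫ x in -r..r, (d x * φ x + f x * deriv φ x)
      rw [this, hz r (by rwa [abs_of_pos hr0]), hz (-r) (by rwa [abs_neg, abs_of_pos hr0])]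
      simp
    rw [integral_add i2 i1] at key
    linarith

end IsPrimitive

/-- The primitive taken from -∞ vanishes to the left of the support, and to the right of it because
the total integral is zero. -/
theorem exists_contDiff_hasCompactSupport_deriv_eq {ξ : ℝ → ℝ} (hξ : ContDiff ℝ ∞ ξ)
    (hc : HasCompactSupport ξ) (h0 : ∫ x, ξ x = 0) :
    ∃ Φ : ℝ → ℝ, ContDiff ℝ ∞ Φ ∧ HasCompactSupport Φ ∧ deriv Φ = ξ := by
  obtain ⟨R, hR⟩ := hc.isCompact.isBounded.subset_closedBall 0
  have hz : ∀ x, R < |x| → ξ x = 0 := fun x hx => image_eq_zero_of_notMem_tsupport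
    fun hm => absurd (hx.trans_le (by simpa using hR hm)) (lt_irrefl _)
  have hder : ∀ x, HasDerivAt (fun x => ∫ t in Iic x, ξ t) (ξ x) x := by
    intro x
    have hi := hξ.continuous.integrable_of_hasCompactSupport (μ := volume) hc
    have : (fun x => ∫ t in Iic x, ξ t) = fun x => (∫ t in Iic 0, ξ t) + ∫ t in (0:ℝ)..x, ξ t := by
      funext y
      rw [intervalIntegral.integral_Iic_sub_Iic hi.integrableOn hi.integrableOn |>.symm]
      ring
    rw [this]
    exact (intervalIntegral.integral_hasDerivAt_right (hξ.continuous.intervalIntegrable _ _)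
      (hξ.continuous.stronglyMeasurableAtFilter _ _) hξ.continuous.continuousAt).const_add _
  have hd : deriv (fun x => ∫ t in Iic x, ξ t) = ξ := funext fun x => (hder x).deriv
  refine ⟨fun x => ∫ t in Iic x, ξ t, ?_, ?_, hd⟩
  · rw [contDiff_infty_iff_deriv, hd]
    exact ⟨fun x => (hder x).differentiableAt, hξ⟩
  · refine HasCompactSupport.intro (isCompact_closedBall (0:ℝ) R) fun x hx => ?_
    have hx' : R < |x| := by simpa using hx
    rcases lt_abs.1 hx' with h | h
    · rw [← h0]
      refine setIntegral_eq_integral_of_forall_compl_eq_zero fun y hy => hz y ?_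
      exact (h.trans (not_le.1 hy)).trans_le (le_abs_self y)
    · refine setIntegral_eq_zero_of_forall_eq_zero fun y hy => hz y ?_
      exact (h.trans_le (neg_le_neg hy)).trans_le (neg_le_abs y)

/-- The du Bois-Reymond lemma. Subtracting from a test function η the multiple (∫ η) θ of a
normalized bump leaves mean zero, hence the derivative of a test function; the constant is therefore
∫ w θ. -/
theorem ae_eq_const_of_integral_mul_deriv_eq_zero {w : ℝ → ℝ} (hw : LocallyIntegrable w)
    (h : ∀ φ : ℝ → ℝ, ContDiff ℝ ∞ φ → HasCompactSupport φ → ∫ x, w x * deriv φ x = 0) :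
    ∃ C : ℝ, w =ᵐ[volume] fun _ => C := by
  let b : ContDiffBump (0 : ℝ) := default
  let θ : ℝ → ℝ := b.normed volume
  have hθ : ContDiff ℝ ∞ θ := b.contDiff_normed
  have hθc : HasCompactSupport θ := b.hasCompactSupport_normed
  have hθ1 : ∫ x, θ x = 1 := b.integral_normed
  have hint : ∀ η : ℝ → ℝ, ContDiff ℝ ∞ η → HasCompactSupport η →
      Integrable fun x => w x * η x := fun η h1 h2 => by
    simpa [mul_comm] using hw.integrable_smul_right_of_hasCompactSupport h1.continuous h2
  refine ⟨∫ x, w x * θ x, ae_eq_of_integral_contDiff_smul_eq hw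
    continuous_const.locallyIntegrable fun η hη hηc => ?_⟩
  have hiη := hη.continuous.integrable_of_hasCompactSupport (μ := volume) hηc
  have hiθ := hθ.continuous.integrable_of_hasCompactSupport (μ := volume) hθc
  obtain ⟨Φ, h1, h2, h3⟩ := exists_contDiff_hasCompactSupport_deriv_eq
    (ξ := fun x => η x - (∫ y, η y) * θ x) (hη.sub (contDiff_const.mul hθ))
    (hηc.sub (hθc.mul_left)) (by
      rw [integral_sub hiη (hiθ.const_mul _), integral_const_mul, hθ1]; ring)
  have key := h Φ h1 h2
  rw [h3] at key
  have e : (fun x => w x * (η x - (∫ y, η y) * θ x)) =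
      fun x => w x * η x - (∫ y, η y) * (w x * θ x) := by funext x; ring
  rw [e, integral_sub (hint η hη hηc) ((hint θ hθ hθc).const_mul _), integral_const_mul] at key
  simp only [smul_eq_mul, mul_comm (η _), integral_const_mul]
  linarith

/-- The difference between f and an indefinite integral of d has weak derivative zero, so it is
constant almost everywhere. -/
theorem IsWeakDeriv.exists_isPrimitive {f d : ℝ → ℝ} (h : IsWeakDeriv f d) :
    ∃ F : ℝ → ℝ, f =ᵐ[volume] F ∧ IsPrimitive F d := by
  have hp := isPrimitive_integral h.locallyIntegrable_deriv 0
  have hw := hp.isWeakDeriv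
  obtain ⟨C, hC⟩ := ae_eq_const_of_integral_mul_deriv_eq_zero
    (w := fun x => f x - ∫ t in (0:ℝ)..x, d t) (h.locallyIntegrable.sub hw.locallyIntegrable)
    (fun φ hφ hc => by
      have hint : ∀ g : ℝ → ℝ, LocallyIntegrable g → Integrable fun x => g x * deriv φ x :=
        fun g hg => by
          simpa [mul_comm] using hg.integrable_smul_right_of_hasCompactSupport
            (hφ.continuous_deriv (by norm_num)) hc.deriv
      simp only [sub_mul]
      rw [integral_sub (hint _ h.locallyIntegrable) (hint _ hw.locallyIntegrable),
        h.integral_eq φ hφ hc, hw.integral_eq φ hφ hc]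
      ring)
  refine ⟨fun x => C + ∫ t in (0:ℝ)..x, d t, ?_, hp.locallyIntegrable, fun x y => ?_⟩
  · filter_upwards [hC] with x hx
    linarith
  · rw [hp.integral_eq]; ring

end Primitive

/-! ### The space H¹(ℝ): bilinear and trilinear forms, sup bound, translations. -/

noncomputable section SobolevSpace
open Set Filter Topology

/-- Discriminant of the nonnegative quadratic t ↦ ∫ (p + t q)². -/
theorem sq_integral_mul_le {p q : ℝ → ℝ} (hp : MemLp p 2) (hq : MemLp q 2) :
    (∫ x, p x * q x) ^ 2 ≤ (∫ x, p x ^ 2) * ∫ x, q x ^ 2 := by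
  have hpq : Integrable fun x => p x * q x := hp.integrable_mul hq
  have h : ∀ t : ℝ, 0 ≤ (∫ x, q x ^ 2) * (t * t) + (2 * ∫ x, p x * q x) * t + ∫ x, p x ^ 2 := by
    intro t
    have h0 : 0 ≤ ∫ x, (p x + t * q x) ^ 2 := integral_nonneg fun x => sq_nonneg _
    have e : (fun x => (p x + t * q x) ^ 2) =
        fun x => (t * t) * q x ^ 2 + ((2 * t) * (p x * q x) + p x ^ 2) := by funext x; ring
    have i1 : Integrable fun x => (2 * t) * (p x * q x) := hpq.const_mul _
    have i2 : Integrable fun x => (2 * t) * (p x * q x) + p x ^ 2 := i1.add hp.integrable_sq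
    rw [e, integral_add (hq.integrable_sq.const_mul _) i2, integral_add i1 hp.integrable_sq,
      integral_const_mul, integral_const_mul] at h0
    linarith
  have := discrim_le_zero h
  simp only [discrim] at this
  nlinarith

/-- The Sobolev space `H¹(ℝ)`, as the space of pairs of a continuous representative and a
square integrable derivative of it. -/
def sobolevH1 : Submodule ℝ ((ℝ → ℝ) × (ℝ → ℝ)) where
  carrier := {p | MemLp p.1 2 ∧ MemLp p.2 2 ∧ IsPrimitive p.1 p.2}
  add_mem' := fun ha hb => ⟨ha.1.add hb.1, ha.2.1.add hb.2.1, ha.2.2.add hb.2.2⟩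
  zero_mem' := ⟨MemLp.zero, MemLp.zero,
    (continuous_const (y := (0 : ℝ))).locallyIntegrable, fun x y => by simp⟩
  smul_mem' := fun c p h => ⟨show MemLp (c • p.1) 2 volume from h.1.const_smul c,
    show MemLp (c • p.2) 2 volume from h.2.1.const_smul c, h.2.2.const_smul c⟩

/-- The type of elements of `H¹(ℝ)`. -/
abbrev H1 : Type := sobolevH1

namespace H1

/-- The continuous representative of an element of `H¹(ℝ)`. -/
def fn (u : H1) : ℝ → ℝ := u.1.1

/-- The derivative of an element of `H¹(ℝ)`. -/
def dv (u : H1) : ℝ → ℝ := u.1.2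

@[simp] theorem fn_add (u v : H1) (x : ℝ) : (u + v).fn x = u.fn x + v.fn x := rfl
@[simp] theorem dv_add (u v : H1) (x : ℝ) : (u + v).dv x = u.dv x + v.dv x := rfl
@[simp] theorem fn_sub (u v : H1) (x : ℝ) : (u - v).fn x = u.fn x - v.fn x := rfl
@[simp] theorem fn_smul (c : ℝ) (u : H1) (x : ℝ) : (c • u).fn x = c * u.fn x := rfl
@[simp] theorem dv_smul (c : ℝ) (u : H1) (x : ℝ) : (c • u).dv x = c * u.dv x := rfl
@[simp] theorem fn_zero (x : ℝ) : (0 : H1).fn x = 0 := rfl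
@[simp] theorem dv_zero (x : ℝ) : (0 : H1).dv x = 0 := rfl

theorem memLp_fn (u : H1) : MemLp u.fn 2 := u.2.1
theorem memLp_dv (u : H1) : MemLp u.dv 2 := u.2.2.1
theorem isPrimitive (u : H1) : IsPrimitive u.fn u.dv := u.2.2.2
theorem continuous_fn (u : H1) : Continuous u.fn := u.isPrimitive.continuous

/-- Construct an element of `H¹(ℝ)` from a function and its derivative. -/
def mk {f d : ℝ → ℝ} (hf : MemLp f 2) (hd : MemLp d 2) (h : IsPrimitive f d) : H1 :=
  ⟨(f, d), hf, hd, h⟩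

@[simp] theorem fn_mk {f d : ℝ → ℝ} (hf : MemLp f 2) (hd : MemLp d 2) (h : IsPrimitive f d) :
    (mk hf hd h).fn = f := rfl

theorem integrable_fn_mul (u v : H1) : Integrable fun x => u.fn x * v.fn x :=
  u.memLp_fn.integrable_mul v.memLp_fn

theorem integrable_dv_mul (u v : H1) : Integrable fun x => u.dv x * v.dv x :=
  u.memLp_dv.integrable_mul v.memLp_dv

theorem integrable_fn_mul_dv (u v : H1) : Integrable fun x => u.fn x * v.dv x :=
  u.memLp_fn.integrable_mul v.memLp_dv

/-- The inner product of `L²` on functions. -/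
def ip (u v : H1) : ℝ := ∫ x, u.fn x * v.fn x

/-- The inner product of `L²` on derivatives. -/
def ipd (u v : H1) : ℝ := ∫ x, u.dv x * v.dv x

theorem ip_comm (u v : H1) : ip u v = ip v u := by simp only [ip, mul_comm]
theorem ipd_comm (u v : H1) : ipd u v = ipd v u := by simp only [ipd, mul_comm]

theorem ip_add_left (u v w : H1) : ip (u + v) w = ip u w + ip v w := by
  simp only [ip, fn_add, add_mul]
  exact integral_add (integrable_fn_mul u w) (integrable_fn_mul v w)

theorem ipd_add_left (u v w : H1) : ipd (u + v) w = ipd u w + ipd v w := by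
  simp only [ipd, dv_add, add_mul]
  exact integral_add (integrable_dv_mul u w) (integrable_dv_mul v w)

theorem ip_smul_left (c : ℝ) (u v : H1) : ip (c • u) v = c * ip u v := by
  simp only [ip, fn_smul, mul_assoc, integral_const_mul]

theorem ipd_smul_left (c : ℝ) (u v : H1) : ipd (c • u) v = c * ipd u v := by
  simp only [ipd, dv_smul, mul_assoc, integral_const_mul]

theorem ip_add_right (u v w : H1) : ip u (v + w) = ip u v + ip u w := by
  rw [ip_comm, ip_add_left, ip_comm v, ip_comm w]

theorem ipd_add_right (u v w : H1) : ipd u (v + w) = ipd u v + ipd u w := by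
  rw [ipd_comm, ipd_add_left, ipd_comm v, ipd_comm w]

theorem ip_smul_right (c : ℝ) (u v : H1) : ip u (c • v) = c * ip u v := by
  rw [ip_comm, ip_smul_left, ip_comm]

theorem ipd_smul_right (c : ℝ) (u v : H1) : ipd u (c • v) = c * ipd u v := by
  rw [ipd_comm, ipd_smul_left, ipd_comm]

theorem ip_self_nonneg (u : H1) : 0 ≤ ip u u := integral_nonneg fun _ => mul_self_nonneg _
theorem ipd_self_nonneg (u : H1) : 0 ≤ ipd u u := integral_nonneg fun _ => mul_self_nonneg _

theorem ip_sub_self (u v : H1) : ip (u - v) (u - v) = ip u u - 2 * ip u v + ip v v := by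
  rw [sub_eq_add_neg, ← neg_one_smul ℝ v]
  simp only [ip_add_left, ip_add_right, ip_smul_left, ip_smul_right, ip_comm v u]; ring

theorem ipd_sub_self (u v : H1) : ipd (u - v) (u - v) = ipd u u - 2 * ipd u v + ipd v v := by
  rw [sub_eq_add_neg, ← neg_one_smul ℝ v]
  simp only [ipd_add_left, ipd_add_right, ipd_smul_left, ipd_smul_right, ipd_comm v u]; ring

/-- Since |(u²)'| ≤ u² + u'², the values of u² at x and at any y in [x, x+1] differ by at most the
full H¹ norm squared; averaging over y gives the bound. -/
theorem sq_fn_le (u : H1) (x : ℝ) : u.fn x ^ 2 ≤ 2 * ip u u + ipd u u := by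
  have hp := u.isPrimitive.mul u.isPrimitive
  have hint : Integrable fun t => u.fn t * u.fn t + u.dv t * u.dv t :=
    (integrable_fn_mul u u).add (integrable_dv_mul u u)
  have hI : ∫ t, (u.fn t * u.fn t + u.dv t * u.dv t) = ip u u + ipd u u :=
    integral_add (integrable_fn_mul u u) (integrable_dv_mul u u)
  have hkey : ∀ y ∈ Icc x (x + 1), u.fn x ^ 2 - (ip u u + ipd u u) ≤ u.fn y * u.fn y := by
    intro y hy
    have h1 := hp.integral_eq x y
    have h2 : -∫ t in x..y, (u.dv t * u.fn t + u.fn t * u.dv t) ≤ ip u u + ipd u u := by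
      rw [← hI, ← intervalIntegral.integral_neg, intervalIntegral.integral_of_le hy.1]
      refine (integral_mono ?_ hint.integrableOn fun t => ?_).trans
        (setIntegral_le_integral hint (Eventually.of_forall fun t =>
          add_nonneg (mul_self_nonneg _) (mul_self_nonneg _)))
      · exact ((hp.locallyIntegrable.intervalIntegrable_real x y).1).neg
      · simp only
        nlinarith [mul_self_nonneg (u.fn t + u.dv t)]
    nlinarith
  have h3 : ∫ _y in x..(x + 1), (u.fn x ^ 2 - (ip u u + ipd u u)) ≤
      ∫ y in x..(x + 1), u.fn y * u.fn y :=
    intervalIntegral.integral_mono_on (by linarith) (by simp)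
      ((u.continuous_fn.mul u.continuous_fn).intervalIntegrable _ _) hkey
  have h4 : ∫ y in x..(x + 1), u.fn y * u.fn y ≤ ip u u := by
    rw [intervalIntegral.integral_of_le (by linarith)]
    exact setIntegral_le_integral (integrable_fn_mul u u)
      (Eventually.of_forall fun t => mul_self_nonneg _)
  simp at h3
  linarith

theorem exists_abs_fn_le (u : H1) : ∃ C, ∀ x, |u.fn x| ≤ C :=
  ⟨√(2 * ip u u + ipd u u), fun x => Real.abs_le_sqrt (u.sq_fn_le x)⟩

theorem memLp_fn_mul (u v : H1) : MemLp (fun x => u.fn x * v.fn x) 2 := by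
  obtain ⟨C, hC⟩ := u.exists_abs_fn_le
  refine (v.memLp_fn.const_mul C).mono
    (u.continuous_fn.mul v.continuous_fn).aestronglyMeasurable (Eventually.of_forall fun x => ?_)
  have : 0 ≤ C := (abs_nonneg _).trans (hC x)
  simp only [norm_mul, Real.norm_eq_abs, abs_of_nonneg this]
  exact mul_le_mul_of_nonneg_right (hC x) (abs_nonneg _)

theorem memLp_fn_mul_dv (u v : H1) : MemLp (fun x => u.fn x * v.dv x) 2 := by
  obtain ⟨C, hC⟩ := u.exists_abs_fn_le
  refine (v.memLp_dv.const_mul C).mono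
    (u.continuous_fn.aestronglyMeasurable.mul v.memLp_dv.1) (Eventually.of_forall fun x => ?_)
  have : 0 ≤ C := (abs_nonneg _).trans (hC x)
  simp only [norm_mul, Real.norm_eq_abs, abs_of_nonneg this]
  exact mul_le_mul_of_nonneg_right (hC x) (abs_nonneg _)

/-- The pointwise square of an element of `H¹(ℝ)`. -/
def sq (u : H1) : H1 :=
  mk (f := fun x => u.fn x * u.fn x) (d := fun x => u.dv x * u.fn x + u.fn x * u.dv x)
    (memLp_fn_mul u u)
    (by
      have := (memLp_fn_mul_dv u u).add (memLp_fn_mul_dv u u)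
      refine this.ae_eq (Eventually.of_forall fun x => ?_)
      simp only [Pi.add_apply]; ring)
    (u.isPrimitive.mul u.isPrimitive)

@[simp] theorem dv_sq (u : H1) (x : ℝ) : u.sq.dv x = u.dv x * u.fn x + u.fn x * u.dv x := rfl

theorem ipd_sq_le (u : H1) : ipd u.sq u.sq ≤ 4 * (2 * ip u u + ipd u u) * ipd u u := by
  rw [show 4 * (2 * ip u u + ipd u u) * ipd u u =
    ∫ x, 4 * (2 * ip u u + ipd u u) * (u.dv x * u.dv x) from (integral_const_mul _ _).symm]
  refine integral_mono (u.sq.integrable_dv_mul u.sq) ((integrable_dv_mul u u).const_mul _) ?_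
  intro x
  have := u.sq_fn_le x
  simp only [dv_sq]
  nlinarith [mul_le_mul_of_nonneg_right this (mul_self_nonneg (u.dv x))]

/-- Translation on `H¹(ℝ)`. -/
def shift (a : ℝ) (u : H1) : H1 :=
  mk (f := fun x => u.fn (x + a)) (d := fun x => u.dv (x + a))
    (u.memLp_fn.comp_measurePreserving (measurePreserving_add_right volume a))
    (u.memLp_dv.comp_measurePreserving (measurePreserving_add_right volume a))
    (u.isPrimitive.comp_add_const a
      ((u.memLp_dv.comp_measurePreserving
        (measurePreserving_add_right volume a)).locallyIntegrable (by norm_num)))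

@[simp] theorem fn_shift (a : ℝ) (u : H1) (x : ℝ) : (shift a u).fn x = u.fn (x + a) := rfl

theorem ip_shift (a : ℝ) (u v : H1) : ip (shift a u) (shift a v) = ip u v :=
  integral_add_right_eq_self (fun x => u.fn x * v.fn x) a

theorem ipd_shift (a : ℝ) (u v : H1) : ipd (shift a u) (shift a v) = ipd u v :=
  integral_add_right_eq_self (fun x => u.dv x * v.dv x) a

/-- The trilinear form `∫ u v w`. -/
def tri (u v w : H1) : ℝ := ∫ x, u.fn x * v.fn x * w.fn x

theorem integrable_tri (u v w : H1) : Integrable fun x => u.fn x * v.fn x * w.fn x :=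
  (memLp_fn_mul u v).integrable_mul w.memLp_fn

theorem tri_comm_left (u v w : H1) : tri u v w = tri v u w := by
  simp only [tri, mul_comm (v.fn _) (u.fn _)]

theorem tri_comm_right (u v w : H1) : tri u v w = tri u w v := by
  simp only [tri, mul_right_comm]

theorem tri_add_left (u u' v w : H1) : tri (u + u') v w = tri u v w + tri u' v w := by
  simp only [tri, fn_add, add_mul]
  exact integral_add (integrable_tri u v w) (integrable_tri u' v w)

theorem tri_smul_left (c : ℝ) (u v w : H1) : tri (c • u) v w = c * tri u v w := by
  simp only [tri, fn_smul, mul_assoc, integral_const_mul]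

theorem tri_add_mid (u v v' w : H1) : tri u (v + v') w = tri u v w + tri u v' w := by
  rw [tri_comm_left, tri_add_left, tri_comm_left v, tri_comm_left v']

theorem tri_smul_mid (c : ℝ) (u v w : H1) : tri u (c • v) w = c * tri u v w := by
  rw [tri_comm_left, tri_smul_left, tri_comm_left]

theorem tri_add_right (u v w w' : H1) : tri u v (w + w') = tri u v w + tri u v w' := by
  rw [tri_comm_right, tri_add_mid, tri_comm_right u w, tri_comm_right u w']

theorem tri_smul_right (c : ℝ) (u v w : H1) : tri u v (c • w) = c * tri u v w := by
  rw [tri_comm_right, tri_smul_mid, tri_comm_right]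

theorem tri_shift (a : ℝ) (u v w : H1) : tri (shift a u) (shift a v) (shift a w) = tri u v w :=
  integral_add_right_eq_self (fun x => u.fn x * v.fn x * w.fn x) a

theorem abs_tri_self_le {C : ℝ} (u v : H1) (hC : ∀ x, |v.fn x| ≤ C) :
    |tri u u v| ≤ C * ip u u := by
  rw [tri, ip, ← integral_const_mul, ← Real.norm_eq_abs]
  refine norm_integral_le_of_norm_le ((integrable_fn_mul u u).const_mul C)
    (Eventually.of_forall fun x => ?_)
  rw [norm_mul, mul_comm, Real.norm_eq_abs, Real.norm_eq_abs, abs_mul_self]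
  exact mul_le_mul_of_nonneg_right (hC x) (mul_self_nonneg _)

/-- Cauchy-Schwarz for u² against v, with one factor u² of u⁴ estimated by its supremum. No
derivative of v enters, which is what permits γ = 0. -/
theorem sq_tri_le (u v : H1) : tri u u v ^ 2 ≤ ((2 * ip u u + ipd u u) * ip u u) * ip v v := by
  have h := sq_integral_mul_le (memLp_fn_mul u u) v.memLp_fn
  have h2 : ∫ x, (u.fn x * u.fn x) ^ 2 ≤ (2 * ip u u + ipd u u) * ip u u := by
    rw [ip, ← integral_const_mul, ← ip]
    refine integral_mono (memLp_fn_mul u u).integrable_sq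
      ((integrable_fn_mul u u).const_mul _) fun x => ?_
    have := u.sq_fn_le x
    simp only
    nlinarith [mul_le_mul_of_nonneg_right this (mul_self_nonneg (u.fn x))]
  have h3 : ∫ x, v.fn x ^ 2 = ip v v := by simp only [ip, pow_two]
  rw [h3] at h
  exact h.trans (mul_le_mul_of_nonneg_right h2 v.ip_self_nonneg)

theorem memH_one (u : H1) : MemH 1 u.fn :=
  ⟨u.memLp_fn, u.dv, u.isPrimitive.isWeakDeriv, u.memLp_dv⟩

theorem weakDeriv_fn (u : H1) : weakDeriv u.fn =ᵐ[volume] u.dv :=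
  u.isPrimitive.isWeakDeriv.weakDeriv_ae_eq

end H1

theorem MemH.exists_H1 {f : ℝ → ℝ} (h : MemH 1 f) :
    ∃ u : H1, f =ᵐ[volume] u.fn ∧ weakDeriv f =ᵐ[volume] u.dv := by
  obtain ⟨hf, d, hd, hd2⟩ := h
  obtain ⟨F, hF, hp⟩ := hd.exists_isPrimitive
  exact ⟨H1.mk (hf.ae_eq hF) hd2 hp, hF, hd.weakDeriv_ae_eq⟩

/-- Smooth compactly supported functions as elements of `H¹(ℝ)`. -/
def H1.ofContDiff {φ : ℝ → ℝ} (hφ : ContDiff ℝ ∞ φ) (hc : HasCompactSupport φ) : H1 :=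
  H1.mk (hφ.continuous.memLp_of_hasCompactSupport hc)
    ((hφ.continuous_deriv (by norm_num)).memLp_of_hasCompactSupport hc.deriv)
    (isPrimitive_deriv (hφ.of_le (by exact_mod_cast le_top)))

end SobolevSpace

/-! ### Weak compactness in H¹(ℝ) and splitting of the forms along weak limits. -/

section WeakCompactness
open Set Filter Topology

/-- Bounded sequences in a separable Hilbert space have weakly convergent subsequences. -/
theorem exists_subseq_tendsto_inner {E : Type*} [NormedAddCommGroup E] [InnerProductSpace ℝ E]
    [CompleteSpace E] [TopologicalSpace.SeparableSpace E] {u : ℕ → E} {B : ℝ}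
    (hu : ∀ n, ‖u n‖ ≤ B) :
    ∃ (v : E) (φ : ℕ → ℕ), StrictMono φ ∧
      ∀ w, Tendsto (fun n => inner ℝ (u (φ n)) w) atTop (𝓝 (inner ℝ v w)) := by
  let D := InnerProductSpace.toDual ℝ E
  obtain ⟨ℓ, -, φ, hφ, hl⟩ := WeakDual.isSeqCompact_closedBall ℝ E 0 B
    (x := fun n => StrongDual.toWeakDual (D (u n))) (fun n => by
      simpa [D] using hu n)
  refine ⟨D.symm (WeakDual.toStrongDual ℓ), φ, hφ, fun w => ?_⟩
  have := (WeakDual.eval_continuous w).continuousAt.tendsto.comp hl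
  have e : inner ℝ (D.symm (WeakDual.toStrongDual ℓ)) w = ℓ w := by
    rw [InnerProductSpace.toDual_symm_apply]; rfl
  rw [e]
  exact this

/-- Bounded sequences in `L²(ℝ)` have weakly convergent subsequences. -/
theorem exists_subseq_tendsto_integral_mul {f : ℕ → ℝ → ℝ} (hf : ∀ n, MemLp (f n) 2) {B : ℝ}
    (hB : ∀ n, ∫ x, f n x * f n x ≤ B) :
    ∃ (e : ℝ → ℝ) (φ : ℕ → ℕ), MemLp e 2 ∧ StrictMono φ ∧ ∀ g : ℝ → ℝ, MemLp g 2 →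
      Tendsto (fun n => ∫ x, f (φ n) x * g x) atTop (𝓝 (∫ x, e x * g x)) := by
  have hin : ∀ {p q : ℝ → ℝ} (hp : MemLp p 2 volume) (hq : MemLp q 2 volume),
      inner ℝ (hp.toLp p) (hq.toLp q) = ∫ x, p x * q x := by
    intro p q hp hq
    rw [L2.inner_def]
    refine integral_congr_ae ?_
    filter_upwards [hp.coeFn_toLp, hq.coeFn_toLp] with x h1 h2
    rw [h1, h2]; simp [mul_comm]
  have : Fact ((2 : ENNReal) ≠ ⊤) := ⟨by norm_num⟩
  obtain ⟨v, φ, hφ, hv⟩ := exists_subseq_tendsto_inner (u := fun n => (hf n).toLp (f n))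
    (B := √B) (fun n => by
      refine Real.le_sqrt_of_sq_le ?_
      rw [← real_inner_self_eq_norm_sq, hin]
      exact hB n)
  refine ⟨v, φ, Lp.memLp v, hφ, fun g hg => ?_⟩
  have h := hv (hg.toLp g)
  simp only [hin] at h
  convert! h using 2
  rw [← hin (Lp.memLp v) hg, Lp.toLp_coeFn]

/-- Interval integrals are pairings with an L² function (a signed indicator), so weak convergence of
derivatives gives convergence of increments at each point. -/
theorem exists_memLp_intervalIntegral_eq (x : ℝ) : ∃ g : ℝ → ℝ, MemLp g 2 ∧
    ∀ d : ℝ → ℝ, ∫ t in (0 : ℝ)..x, d t = ∫ t, d t * g t := by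
  have hm : ∀ a b : ℝ, MemLp ((Ioc a b).indicator fun _ => (1 : ℝ)) 2 volume := fun a b =>
    memLp_indicator_const _ measurableSet_Ioc _ (Or.inr (by simp))
  have hi : ∀ (a b : ℝ) (d : ℝ → ℝ), ∫ t, d t * (Ioc a b).indicator (fun _ => (1 : ℝ)) t =
      ∫ t in Ioc a b, d t := fun a b d => by
    rw [← integral_indicator measurableSet_Ioc]
    refine integral_congr_ae (Eventually.of_forall fun t => ?_)
    by_cases ht : t ∈ Ioc a b <;> simp [ht]
  rcases le_total 0 x with h | h
  · exact ⟨_, hm 0 x, fun d => by rw [hi, intervalIntegral.integral_of_le h]⟩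
  · refine ⟨_, (hm x 0).neg, fun d => ?_⟩
    simp only [Pi.neg_apply, mul_neg, integral_neg]
    rw [hi, intervalIntegral.integral_of_ge h]

namespace H1

/-- Weak convergence in `H¹(ℝ)` in the form used for splitting functionals: bounded, pointwise
convergent, and with convergence of the pairings with the limit. -/
structure WeakConv (u : ℕ → H1) (v : H1) : Prop where
  bdd : ∃ B, ∀ n, ip (u n) (u n) ≤ B ∧ ipd (u n) (u n) ≤ B
  pointwise : ∀ x, Tendsto (fun n => (u n).fn x) atTop (𝓝 (v.fn x))
  tendsto_ip : Tendsto (fun n => ip (u n) v) atTop (𝓝 (ip v v))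
  tendsto_ipd : Tendsto (fun n => ipd (u n) v) atTop (𝓝 (ipd v v))

theorem WeakConv.comp {u : ℕ → H1} {v : H1} (h : WeakConv u v) {φ : ℕ → ℕ} (hφ : StrictMono φ) :
    WeakConv (u ∘ φ) v where
  bdd := h.bdd.imp fun _ hB _ => hB _
  pointwise x := (h.pointwise x).comp hφ.tendsto_atTop
  tendsto_ip := h.tendsto_ip.comp hφ.tendsto_atTop
  tendsto_ipd := h.tendsto_ipd.comp hφ.tendsto_atTop

theorem exists_subseq_weakConv {u : ℕ → H1} {B : ℝ}
    (hB : ∀ n, ip (u n) (u n) ≤ B ∧ ipd (u n) (u n) ≤ B) :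
    ∃ (v : H1) (φ : ℕ → ℕ), StrictMono φ ∧ WeakConv (u ∘ φ) v := by
  obtain ⟨d, φ₁, hd, hφ₁, h₁⟩ := exists_subseq_tendsto_integral_mul
    (fun n => (u n).memLp_dv) (fun n => (hB n).2)
  obtain ⟨e, φ₂, he, hφ₂, h₂⟩ := exists_subseq_tendsto_integral_mul
    (fun n => (u (φ₁ n)).memLp_fn) (fun n => (hB (φ₁ n)).1)
  have hsup : ∀ n x, |(u n).fn x| ≤ √(3 * B) := fun n x =>
    Real.abs_le_sqrt (((u n).sq_fn_le x).trans (by linarith [(hB n).1, (hB n).2]))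
  -- The weak limit of the derivatives determines the limit function only up to a constant, which is
  -- fixed by making the values at 0 converge as well.
  obtain ⟨y, -, φ₃, hφ₃, h₃⟩ := tendsto_subseq_of_bounded
    (x := fun n => (u (φ₁ (φ₂ n))).fn 0) (Metric.isBounded_closedBall (x := (0:ℝ)) (r := √(3 * B)))
    (fun n => by simpa using hsup _ 0)
  let φ := φ₁ ∘ φ₂ ∘ φ₃
  have hd' : ∀ g : ℝ → ℝ, MemLp g 2 →
      Tendsto (fun n => ∫ x, (u (φ n)).dv x * g x) atTop (𝓝 (∫ x, d x * g x)) := fun g hg =>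
    (h₁ g hg).comp (hφ₂.comp hφ₃).tendsto_atTop
  have he' : ∀ g : ℝ → ℝ, MemLp g 2 →
      Tendsto (fun n => ∫ x, (u (φ n)).fn x * g x) atTop (𝓝 (∫ x, e x * g x)) := fun g hg =>
    (h₂ g hg).comp hφ₃.tendsto_atTop
  have hdl : LocallyIntegrable d := hd.locallyIntegrable (by norm_num)
  let f : ℝ → ℝ := fun x => y + ∫ t in (0:ℝ)..x, d t
  have hp0 := isPrimitive_integral hdl 0
  have hp : IsPrimitive f d := ⟨hdl, fun a b => by
    rw [hp0.integral_eq]; simp only [f]; ring⟩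
  have hpt : ∀ x, Tendsto (fun n => (u (φ n)).fn x) atTop (𝓝 (f x)) := by
    intro x
    obtain ⟨g, hg, hgi⟩ := exists_memLp_intervalIntegral_eq x
    have : ∀ n, (u (φ n)).fn x = (u (φ n)).fn 0 + ∫ t, (u (φ n)).dv t * g t := fun n => by
      rw [← hgi]; exact (u (φ n)).isPrimitive.eq_add 0 x
    simp only [this, f, hgi]
    exact Tendsto.add h₃ (hd' g hg)
  -- The weak L² limit and the pointwise limit agree: tested against a bump, the pointwise limit may
  -- be taken under the integral by the uniform sup bound.
  have hef : e =ᵐ[volume] f := by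
    refine ae_eq_of_integral_contDiff_smul_eq (he.locallyIntegrable (by norm_num))
      hp.continuous.locallyIntegrable fun η hη hηc => ?_
    simp only [smul_eq_mul, mul_comm (η _)]
    refine tendsto_nhds_unique (he' η (hη.continuous.memLp_of_hasCompactSupport hηc)) ?_
    refine tendsto_integral_of_dominated_convergence (fun x => √(3 * B) * |η x|)
      (fun n => ((u (φ n)).continuous_fn.mul hη.continuous).aestronglyMeasurable)
      ((hη.continuous.integrable_of_hasCompactSupport hηc).abs.const_mul _)
      (fun n => Eventually.of_forall fun x => ?_)
      (Eventually.of_forall fun x => (hpt x).mul_const _)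
    rw [norm_mul]
    exact mul_le_mul_of_nonneg_right (hsup _ x) (abs_nonneg _)
  have hf : MemLp f 2 := he.ae_eq hef
  refine ⟨mk hf hd hp, φ, hφ₁.comp (hφ₂.comp hφ₃), ⟨B, fun _ => hB _⟩, hpt, ?_, hd' d hd⟩
  have := he' f hf
  rwa [show ∫ x, e x * f x = ∫ x, f x * f x from
    integral_congr_ae (hef.mono fun x hx => by simp only [hx])] at this

theorem exists_subseq_weakConv_pi {ι : Type*} [Finite ι] {u : ι → ℕ → H1} {B : ℝ}
    (hB : ∀ i n, ip (u i n) (u i n) ≤ B ∧ ipd (u i n) (u i n) ≤ B) :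
    ∃ (v : ι → H1) (φ : ℕ → ℕ), StrictMono φ ∧ ∀ i, WeakConv (u i ∘ φ) (v i) := by
  classical
  have := Fintype.ofFinite ι
  suffices h : ∀ s : Finset ι, ∃ (v : ι → H1) (φ : ℕ → ℕ), StrictMono φ ∧
      ∀ i ∈ s, WeakConv (u i ∘ φ) (v i) by
    obtain ⟨v, φ, hφ, h⟩ := h Finset.univ
    exact ⟨v, φ, hφ, fun i => h i (Finset.mem_univ i)⟩
  intro s
  induction s using Finset.induction_on with
  | empty => exact ⟨0, id, strictMono_id, by simp⟩
  | insert i s hi ih =>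
    obtain ⟨v, φ, hφ, h⟩ := ih
    obtain ⟨w, ψ, hψ, hw⟩ := exists_subseq_weakConv (fun n => hB i (φ n))
    refine ⟨Function.update v i w, φ ∘ ψ, hφ.comp hψ, fun j hj => ?_⟩
    by_cases hji : j = i
    · subst hji
      rwa [Function.update_self]
    · rw [Function.update_of_ne hji]
      exact (h j (Finset.mem_of_mem_insert_of_ne hj hji)).comp hψ

namespace WeakConv

variable {u : ℕ → H1} {v : H1}

theorem exists_abs_fn_le (h : WeakConv u v) : ∃ C, ∀ n x, |(u n).fn x| ≤ C := by
  obtain ⟨B, hB⟩ := h.bdd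
  exact ⟨√(3 * B), fun n x =>
    Real.abs_le_sqrt (((u n).sq_fn_le x).trans (by linarith [(hB n).1, (hB n).2]))⟩

theorem const (v : H1) : WeakConv (fun _ => v) v where
  bdd := ⟨max (ip v v) (ipd v v), fun _ => ⟨le_max_left _ _, le_max_right _ _⟩⟩
  pointwise _ := tendsto_const_nhds
  tendsto_ip := tendsto_const_nhds
  tendsto_ipd := tendsto_const_nhds

/-- Expanding the square leaves 2⟨uₙ, v⟩ - ⟨v, v⟩, so the norm decouples although it need not
converge. -/
theorem tendsto_ip_sub (h : WeakConv u v) :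
    Tendsto (fun n => ip (u n) (u n) - ip (u n - v) (u n - v)) atTop (𝓝 (ip v v)) := by
  have := (h.tendsto_ip.const_mul 2).sub_const (ip v v)
  simp only [ip_sub_self]
  convert! this using 2 <;> ring

theorem tendsto_ipd_sub (h : WeakConv u v) :
    Tendsto (fun n => ipd (u n) (u n) - ipd (u n - v) (u n - v)) atTop (𝓝 (ipd v v)) := by
  have := (h.tendsto_ipd.const_mul 2).sub_const (ipd v v)
  simp only [ipd_sub_self]
  convert! this using 2 <;> ring

theorem sub_limit (h : WeakConv u v) : WeakConv (fun n => u n - v) 0 where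
  bdd := by
    obtain ⟨B, hB⟩ := h.bdd
    obtain ⟨b1, h1⟩ := h.tendsto_ip_sub.bddBelow_range
    obtain ⟨b2, h2⟩ := h.tendsto_ipd_sub.bddBelow_range
    refine ⟨max (B - b1) (B - b2), fun n => ⟨le_max_of_le_left ?_, le_max_of_le_right ?_⟩⟩
    · linarith [h1 (mem_range_self n), (hB n).1]
    · linarith [h2 (mem_range_self n), (hB n).2]
  pointwise x := by simpa using (h.pointwise x).sub_const (v.fn x)
  tendsto_ip := by simp [ip]
  tendsto_ipd := by simp [ipd]

/-- The trilinear form with a fixed first entry vanishes along a sequence tending weakly to `0`. -/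
theorem tendsto_tri_zero (h : WeakConv u 0) (a : H1) {w : ℕ → H1} {b : H1} (hw : WeakConv w b) :
    Tendsto (fun n => tri a (u n) (w n)) atTop (𝓝 0) := by
  obtain ⟨B, hB⟩ := hw.bdd
  obtain ⟨C, hC⟩ := h.exists_abs_fn_le
  have hdom : Tendsto (fun n => ∫ x, (a.fn x * (u n).fn x) ^ 2) atTop (𝓝 (∫ _ : ℝ, (0:ℝ))) := by
    refine tendsto_integral_of_dominated_convergence (fun x => C ^ 2 * (a.fn x) ^ 2)
      (fun n => ((a.continuous_fn.mul (u n).continuous_fn).pow 2).aestronglyMeasurable)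
      (a.memLp_fn.integrable_sq.const_mul _) (fun n => Eventually.of_forall fun x => ?_)
      (Eventually.of_forall fun x => ?_)
    · rw [Real.norm_eq_abs, abs_of_nonneg (sq_nonneg _), mul_pow, mul_comm]
      exact mul_le_mul_of_nonneg_right (sq_le_sq' (abs_le.1 (hC n x)).1 (abs_le.1 (hC n x)).2)
        (sq_nonneg _)
    · simpa using ((h.pointwise x).const_mul (a.fn x)).pow 2
  rw [integral_zero] at hdom
  -- The fixed factor a localizes: a uₙ tends to 0 in L² by dominated convergence, with majorant
  -- C²a², while wₙ stays bounded in L².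
  have hsq : Tendsto (fun n => tri a (u n) (w n) ^ 2) atTop (𝓝 0) := by
    refine squeeze_zero (fun n => sq_nonneg _) (fun n => ?_) (by simpa using hdom.mul_const B)
    refine (sq_integral_mul_le (memLp_fn_mul a (u n)) (w n).memLp_fn).trans ?_
    refine mul_le_mul_of_nonneg_left ?_ (integral_nonneg fun x => sq_nonneg _)
    simpa [ip, pow_two] using (hB n).1
  have := hsq.sqrt
  simp only [Real.sqrt_sq_eq_abs, Real.sqrt_zero] at this
  exact (tendsto_zero_iff_abs_tendsto_zero _).2 this

/-- A Brezis-Lieb splitting. Writing each entry as limit plus remainder and expanding, every mixed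
term contains a fixed entry and a remainder tending weakly to 0, so it vanishes by
`tendsto_tri_zero`. -/
theorem tendsto_tri_sub {p q r : ℕ → H1} {a b c : H1} (hp : WeakConv p a) (hq : WeakConv q b)
    (hr : WeakConv r c) :
    Tendsto (fun n => tri (p n) (q n) (r n) - tri (p n - a) (q n - b) (r n - c)) atTop
      (𝓝 (tri a b c)) := by
  have key : ∀ a b c p q r : H1, tri (p + a) (q + b) (r + c) - tri p q r =
      tri a b c + tri a r b + tri a q c + tri a q r + tri b p c + tri b p r + tri c p q := by
    intro a b c p q r
    simp only [tri_add_left, tri_add_mid, tri_add_right]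
    rw [tri_comm_right a r b, tri_comm_left b p c, tri_comm_left b p r,
      tri_comm_left c p q, tri_comm_right p c q]
    ring
  have h : ∀ n, tri (p n) (q n) (r n) - tri (p n - a) (q n - b) (r n - c) =
      tri a b c + tri a (r n - c) b + tri a (q n - b) c + tri a (q n - b) (r n - c) +
      tri b (p n - a) c + tri b (p n - a) (r n - c) + tri c (p n - a) (q n - b) := by
    intro n
    simpa using key a b c (p n - a) (q n - b) (r n - c)
  simp only [h]
  have hp' := hp.sub_limit
  have hq' := hq.sub_limit
  have hr' := hr.sub_limit
  simpa using (((((tendsto_const_nhds (x := tri a b c)).add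
    (hr'.tendsto_tri_zero a (const b))).add
    (hq'.tendsto_tri_zero a (const c))).add (hq'.tendsto_tri_zero a hr')).add
    (hp'.tendsto_tri_zero b (const c))).add (hp'.tendsto_tri_zero b hr') |>.add
    (hp'.tendsto_tri_zero c hq')

end WeakConv

end H1

end WeakCompactness

/-! ### The energy and the constraint as functionals on tuples in H¹(ℝ). -/

noncomputable section VariationalProblem
open Set Filter Topology

namespace H1

theorem tri_eq_ip_sq (u v : H1) : tri u u v = ip u.sq v := rfl

theorem ipd_add_self_le (u v : H1) : ipd (u + v) (u + v) ≤ 2 * ipd u u + 2 * ipd v v := by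
  have h := ipd_self_nonneg (u - v)
  rw [ipd_sub_self] at h
  simp only [ipd_add_left, ipd_add_right, ipd_comm v u]
  linarith

theorem ip_self_pos {u : H1} {x : ℝ} (hx : u.fn x ≠ 0) : 0 < ip u u :=
  integral_pos_of_integrable_nonneg_nonzero (u.continuous_fn.mul u.continuous_fn)
    (integrable_fn_mul u u) (fun x => mul_self_nonneg (u.fn x)) (mul_self_ne_zero.2 hx)

end H1

namespace LSI
open H1

variable {N : ℕ}

/-- Tuples of `N + 1` elements of `H¹(ℝ)`. -/
abbrev Tuple (N : ℕ) : Type := (Fin N → H1) × H1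

/-- The energy on tuples of elements of `H¹(ℝ)`. -/
def quad (c σ τ γ : ℝ) (u : Tuple N) : ℝ :=
  ∑ j, (ipd (u.1 j) (u.1 j) + σ * ip (u.1 j) (u.1 j)) + (γ * ipd u.2 u.2 + (c - τ) * ip u.2 u.2)

/-- The polarization of the energy. -/
def bil (c σ τ γ : ℝ) (u h : Tuple N) : ℝ :=
  ∑ j, (ipd (u.1 j) (h.1 j) + σ * ip (u.1 j) (h.1 j)) + (γ * ipd u.2 h.2 + (c - τ) * ip u.2 h.2)

/-- The constraint functional on tuples of elements of `H¹(ℝ)`. -/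
def cubic (β : ℝ) (α : Fin N → ℝ) (u : Tuple N) : ℝ :=
  1 / 3 * β * tri u.2 u.2 u.2 + ∑ j, α j * tri (u.1 j) (u.1 j) u.2

/-- The derivative of the constraint functional. -/
def dcubic (β : ℝ) (α : Fin N → ℝ) (u h : Tuple N) : ℝ :=
  β * tri u.2 u.2 h.2 + ∑ j, α j * (2 * tri (u.1 j) u.2 (h.1 j) + tri (u.1 j) (u.1 j) h.2)

/-- The underlying tuple of functions. -/
def Tuple.toFun (u : Tuple N) : (Fin N → ℝ → ℝ) × (ℝ → ℝ) := (fun j => (u.1 j).fn, u.2.fn)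

/-! ### Passage from Sobolev representatives to elements of `H1`. -/

section Bridge

variable {p : (Fin N → ℝ → ℝ) × (ℝ → ℝ)} {u : Tuple N}

theorem energy_eq_quad (c σ τ γ : ℝ) (h1 : ∀ j, p.1 j =ᵐ[volume] (u.1 j).fn)
    (h2 : p.2 =ᵐ[volume] u.2.fn) (d1 : ∀ j, weakDeriv (p.1 j) =ᵐ[volume] (u.1 j).dv)
    (d2 : weakDeriv p.2 =ᵐ[volume] u.2.dv) : energy c σ τ γ p = quad c σ τ γ u := by
  have e : energy c σ τ γ p = ∫ x, ((∑ j, ((u.1 j).dv x * (u.1 j).dv x +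
      σ * ((u.1 j).fn x * (u.1 j).fn x))) +
      (γ * (u.2.dv x * u.2.dv x) + (c - τ) * (u.2.fn x * u.2.fn x))) := by
    refine integral_congr_ae ?_
    filter_upwards [ae_all_iff.2 h1, ae_all_iff.2 d1, h2, d2] with x a1 a2 a3 a4
    simp only [a1, a2, a3, a4, pow_two]
  have i1 : ∀ j, Integrable fun x => (u.1 j).dv x * (u.1 j).dv x +
      σ * ((u.1 j).fn x * (u.1 j).fn x) := fun j =>
    (integrable_dv_mul _ _).add ((integrable_fn_mul _ _).const_mul σ)
  have i2 : Integrable fun x => γ * (u.2.dv x * u.2.dv x) + (c - τ) * (u.2.fn x * u.2.fn x) :=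
    ((integrable_dv_mul _ _).const_mul _).add ((integrable_fn_mul _ _).const_mul _)
  rw [e, integral_add (integrable_finsetSum _ fun j _ => i1 j) i2,
    integral_finsetSum _ fun j _ => i1 j, integral_add ((integrable_dv_mul _ _).const_mul _)
      ((integrable_fn_mul _ _).const_mul _), integral_const_mul, integral_const_mul]
  simp only [quad, ip, ipd]
  congr 1
  refine Finset.sum_congr rfl fun j _ => ?_
  rw [integral_add (integrable_dv_mul _ _) ((integrable_fn_mul _ _).const_mul σ),
    integral_const_mul]

theorem integral_density_eq_cubic (β : ℝ) (α : Fin N → ℝ)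
    (h1 : ∀ j, p.1 j =ᵐ[volume] (u.1 j).fn) (h2 : p.2 =ᵐ[volume] u.2.fn) :
    ∫ x, density β α (fun j => p.1 j x) (p.2 x) = cubic β α u := by
  have e : ∫ x, density β α (fun j => p.1 j x) (p.2 x) =
      ∫ x, (1 / 3 * β * (u.2.fn x * u.2.fn x * u.2.fn x) +
        ∑ j, α j * ((u.1 j).fn x * (u.1 j).fn x * u.2.fn x)) := by
    refine integral_congr_ae ?_
    filter_upwards [ae_all_iff.2 h1, h2] with x a1 a2
    simp only [density, a1, a2, Finset.sum_mul]
    congr 1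
    · ring
    · exact Finset.sum_congr rfl fun j _ => by ring
  have i1 : ∀ j, Integrable fun x => α j * ((u.1 j).fn x * (u.1 j).fn x * u.2.fn x) := fun j =>
    (integrable_tri _ _ _).const_mul _
  rw [e, integral_add ((integrable_tri _ _ _).const_mul _) (integrable_finsetSum _ fun j _ => i1 j),
    integral_finsetSum _ fun j _ => i1 j, integral_const_mul]
  simp only [integral_const_mul, cubic, tri]

theorem exists_tuple (h1 : ∀ j, MemH 1 (p.1 j)) (h2 : MemH 1 p.2) :
    ∃ u : Tuple N, (∀ j, p.1 j =ᵐ[volume] (u.1 j).fn) ∧ p.2 =ᵐ[volume] u.2.fn ∧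
      (∀ j, weakDeriv (p.1 j) =ᵐ[volume] (u.1 j).dv) ∧ weakDeriv p.2 =ᵐ[volume] u.2.dv := by
  choose f hf hf' using fun j => (h1 j).exists_H1
  obtain ⟨g, hg, hg'⟩ := h2.exists_H1
  exact ⟨(f, g), hf, hg, hf', hg'⟩

theorem energy_toFun (c σ τ γ : ℝ) (u : Tuple N) : energy c σ τ γ u.toFun = quad c σ τ γ u :=
  energy_eq_quad c σ τ γ (fun _ => EventuallyEq.rfl) EventuallyEq.rfl
    (fun j => (u.1 j).weakDeriv_fn) u.2.weakDeriv_fn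

theorem toFun_mem_admissible {β lam : ℝ} {α : Fin N → ℝ} :
    u.toFun ∈ admissible β α lam ↔ cubic β α u = lam := by
  rw [← integral_density_eq_cubic (p := u.toFun) β α (fun _ => EventuallyEq.rfl) EventuallyEq.rfl]
  exact ⟨fun h => h.2.2, fun h => ⟨fun j => (u.1 j).memH_one, u.2.memH_one, h⟩⟩

end Bridge

section Algebra

theorem quad_add_smul (c σ τ γ t : ℝ) (u h : Tuple N) :
    quad c σ τ γ (u + t • h) =
      quad c σ τ γ u + 2 * t * bil c σ τ γ u h + t ^ 2 * quad c σ τ γ h := by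
  have e : ∀ j, ipd (u.1 j + t • h.1 j) (u.1 j + t • h.1 j) +
      σ * ip (u.1 j + t • h.1 j) (u.1 j + t • h.1 j) =
      (ipd (u.1 j) (u.1 j) + σ * ip (u.1 j) (u.1 j)) +
      2 * t * (ipd (u.1 j) (h.1 j) + σ * ip (u.1 j) (h.1 j)) +
      t ^ 2 * (ipd (h.1 j) (h.1 j) + σ * ip (h.1 j) (h.1 j)) := fun j => by
    simp only [ip_add_left, ip_add_right, ip_smul_left, ip_smul_right, ipd_add_left,
      ipd_add_right, ipd_smul_left, ipd_smul_right, ip_comm (h.1 j) (u.1 j),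
      ipd_comm (h.1 j) (u.1 j)]
    ring
  simp only [quad, bil, Prod.fst_add, Prod.snd_add, Prod.smul_fst, Prod.smul_snd, Pi.add_apply,
    Pi.smul_apply, e, Finset.sum_add_distrib, ← Finset.mul_sum]
  simp only [ip_add_left, ip_add_right, ip_smul_left, ip_smul_right, ipd_add_left,
      ipd_add_right, ipd_smul_left, ipd_smul_right, ip_comm h.2 u.2, ipd_comm h.2 u.2]
  ring

theorem quad_smul (c σ τ γ t : ℝ) (u : Tuple N) :
    quad c σ τ γ (t • u) = t ^ 2 * quad c σ τ γ u := by
  simp only [quad, Prod.smul_fst, Prod.smul_snd, Pi.smul_apply, ip_smul_left, ip_smul_right,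
    ipd_smul_left, ipd_smul_right, mul_add, Finset.mul_sum]
  congr 1
  · exact Finset.sum_congr rfl fun j _ => by ring
  · ring

theorem cubic_smul (β t : ℝ) (α : Fin N → ℝ) (u : Tuple N) :
    cubic β α (t • u) = t ^ 3 * cubic β α u := by
  simp only [cubic, Prod.smul_fst, Prod.smul_snd, Pi.smul_apply, tri_smul_left, tri_smul_mid,
    tri_smul_right, mul_add, Finset.mul_sum]
  congr 1
  · ring
  · exact Finset.sum_congr rfl fun j _ => by ring

theorem cubic_add_smul (β : ℝ) (α : Fin N → ℝ) (u h : Tuple N) :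
    ∃ D, ∀ t, cubic β α (u + t • h) =
      cubic β α u + t * dcubic β α u h + t ^ 2 * D + t ^ 3 * cubic β α h := by
  refine ⟨β * tri u.2 h.2 h.2 + ∑ j, α j * (2 * tri (u.1 j) (h.1 j) h.2 +
    tri (h.1 j) (h.1 j) u.2), fun t => ?_⟩
  have e : ∀ j, α j * tri (u.1 j + t • h.1 j) (u.1 j + t • h.1 j) (u.2 + t • h.2) =
      α j * tri (u.1 j) (u.1 j) u.2 +
      t * (α j * (2 * tri (u.1 j) u.2 (h.1 j) + tri (u.1 j) (u.1 j) h.2)) +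
      t ^ 2 * (α j * (2 * tri (u.1 j) (h.1 j) h.2 + tri (h.1 j) (h.1 j) u.2)) +
      t ^ 3 * (α j * tri (h.1 j) (h.1 j) h.2) := fun j => by
    simp only [tri_add_left, tri_add_mid, tri_add_right, tri_smul_left, tri_smul_mid,
      tri_smul_right]
    rw [tri_comm_left (h.1 j) (u.1 j), tri_comm_left (h.1 j) (u.1 j),
      tri_comm_right (u.1 j) u.2 (h.1 j)]
    ring
  simp only [cubic, dcubic, Prod.fst_add, Prod.snd_add, Prod.smul_fst, Prod.smul_snd,
    Pi.add_apply, Pi.smul_apply, e, Finset.sum_add_distrib, ← Finset.mul_sum]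
  simp only [tri_add_left, tri_add_mid, tri_add_right, tri_smul_left, tri_smul_mid,
      tri_smul_right]
  rw [tri_comm_left h.2 u.2 u.2, tri_comm_left h.2 u.2 h.2, tri_comm_right u.2 h.2 u.2,
    tri_comm_right h.2 h.2 u.2, tri_comm_left h.2 u.2 h.2]
  ring

/-- Simultaneous translation of all components. -/
def Tuple.shift (a : ℝ) (u : Tuple N) : Tuple N := (fun j => H1.shift a (u.1 j), H1.shift a u.2)

theorem quad_shift (c σ τ γ a : ℝ) (u : Tuple N) : quad c σ τ γ (u.shift a) = quad c σ τ γ u := by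
  simp only [quad, Tuple.shift, ip_shift, ipd_shift]

theorem cubic_shift (β a : ℝ) (α : Fin N → ℝ) (u : Tuple N) :
    cubic β α (u.shift a) = cubic β α u := by
  simp only [cubic, Tuple.shift, tri_shift]

end Algebra

/-! ### Coercivity and bounds of the constraint by the energy. -/

section Bounds

variable {c σ τ β γ : ℝ} {α : Fin N → ℝ}

theorem quad_short_nonneg (hσ : 0 < σ) (u : Tuple N) (j : Fin N) :
    0 ≤ ipd (u.1 j) (u.1 j) + σ * ip (u.1 j) (u.1 j) :=
  add_nonneg (ipd_self_nonneg _) (mul_nonneg hσ.le (ip_self_nonneg _))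

theorem quad_long_nonneg (hτ : τ < c) (hγ : 0 ≤ γ) (u : Tuple N) :
    0 ≤ γ * ipd u.2 u.2 + (c - τ) * ip u.2 u.2 :=
  add_nonneg (mul_nonneg hγ (ipd_self_nonneg _)) (mul_nonneg (by linarith) (ip_self_nonneg _))

theorem short_le_quad (hσ : 0 < σ) (hτ : τ < c) (hγ : 0 ≤ γ) (u : Tuple N) (j : Fin N) :
    ipd (u.1 j) (u.1 j) + σ * ip (u.1 j) (u.1 j) ≤ quad c σ τ γ u :=
  (Finset.single_le_sum (f := fun j => ipd (u.1 j) (u.1 j) + σ * ip (u.1 j) (u.1 j))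
    (fun i _ => quad_short_nonneg hσ u i) (Finset.mem_univ j)).trans
    (le_add_of_nonneg_right (quad_long_nonneg hτ hγ u))

theorem long_le_quad (hσ : 0 < σ) (u : Tuple N) :
    γ * ipd u.2 u.2 + (c - τ) * ip u.2 u.2 ≤ quad c σ τ γ u :=
  le_add_of_nonneg_left (Finset.sum_nonneg fun i _ => quad_short_nonneg hσ u i)

theorem quad_nonneg (hσ : 0 < σ) (hτ : τ < c) (hγ : 0 ≤ γ) (u : Tuple N) :
    0 ≤ quad c σ τ γ u :=
  (quad_long_nonneg hτ hγ u).trans (long_le_quad hσ u)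

theorem ipd_short_le (hσ : 0 < σ) (hτ : τ < c) (hγ : 0 ≤ γ) (u : Tuple N) (j : Fin N) :
    ipd (u.1 j) (u.1 j) ≤ quad c σ τ γ u := by
  have := short_le_quad hσ hτ hγ u j
  nlinarith [ip_self_nonneg (u.1 j)]

theorem ip_short_le (hσ : 0 < σ) (hτ : τ < c) (hγ : 0 ≤ γ) (u : Tuple N) (j : Fin N) :
    ip (u.1 j) (u.1 j) ≤ quad c σ τ γ u / σ := by
  have := short_le_quad hσ hτ hγ u j
  rw [le_div_iff₀ hσ]
  nlinarith [ipd_self_nonneg (u.1 j)]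

theorem ip_long_le (hσ : 0 < σ) (hτ : τ < c) (hγ : 0 ≤ γ) (u : Tuple N) :
    ip u.2 u.2 ≤ quad c σ τ γ u / (c - τ) := by
  have := long_le_quad (c := c) (τ := τ) (γ := γ) hσ u
  rw [le_div_iff₀ (by linarith)]
  nlinarith [mul_nonneg hγ (ipd_self_nonneg u.2)]

theorem ipd_long_le (hσ : 0 < σ) (hτ : τ < c) (hγ : 0 < γ) (u : Tuple N) :
    ipd u.2 u.2 ≤ quad c σ τ γ u / γ := by
  have := long_le_quad (c := c) (τ := τ) (γ := γ) hσ u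
  rw [le_div_iff₀ hγ]
  nlinarith [mul_nonneg (sub_nonneg.2 hτ.le) (ip_self_nonneg u.2)]

/-- Makes the infimum positive. The coupling terms need only the L² norm of the last component; the
pure cube needs its derivative too, whence the alternative γ > 0 or β = 0. -/
theorem exists_sq_cubic_le (hσ : 0 < σ) (hτ : τ < c) (hγ : 0 ≤ γ) (hγβ : 0 < γ ∨ β = 0) :
    ∃ C, 0 < C ∧ ∀ u : Tuple N, cubic β α u ^ 2 ≤ C * quad c σ τ γ u ^ 3 := by
  have hτ' : 0 < c - τ := sub_pos.2 hτ
  have hshort : ∃ C, 0 ≤ C ∧ ∀ (u : Tuple N) j,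
      |tri (u.1 j) (u.1 j) u.2| ≤ C * √(quad c σ τ γ u ^ 3) := by
    refine ⟨√((2 / σ + 1) * (1 / σ) * (1 / (c - τ))), Real.sqrt_nonneg _, fun u j => ?_⟩
    rw [← Real.sqrt_mul (by positivity)]
    refine Real.abs_le_sqrt ((sq_tri_le _ _).trans ?_)
    have hk := quad_nonneg hσ hτ hγ u
    have h1 := ip_short_le hσ hτ hγ u j
    have h2 := ipd_short_le hσ hτ hγ u j
    have h3 := ip_long_le hσ hτ hγ u
    have h4 := ip_self_nonneg (u.1 j)
    have h5 := ip_self_nonneg u.2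
    generalize quad c σ τ γ u = k at *
    have : (2 / σ + 1) * (1 / σ) * (1 / (c - τ)) * k ^ 3 =
      ((2 * (k / σ) + k) * (k / σ)) * (k / (c - τ)) := by ring
    rw [this]
    gcongr
  have hlong : ∃ C, 0 ≤ C ∧ ∀ u : Tuple N,
      |1 / 3 * β * tri u.2 u.2 u.2| ≤ C * √(quad c σ τ γ u ^ 3) := by
    rcases hγβ with hγ' | rfl
    · refine ⟨|1 / 3 * β| * √((2 / (c - τ) + 1 / γ) * (1 / (c - τ)) * (1 / (c - τ))),
        by positivity, fun u => ?_⟩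
      rw [abs_mul, mul_assoc, ← Real.sqrt_mul (by positivity)]
      refine mul_le_mul_of_nonneg_left (Real.abs_le_sqrt ((sq_tri_le _ _).trans ?_))
        (abs_nonneg _)
      have hk := quad_nonneg hσ hτ hγ u
      have h2 := ipd_long_le hσ hτ hγ' u
      have h3 := ip_long_le hσ hτ hγ u
      have h5 := ip_self_nonneg u.2
      generalize quad c σ τ γ u = k at *
      have : (2 / (c - τ) + 1 / γ) * (1 / (c - τ)) * (1 / (c - τ)) * k ^ 3 =
        ((2 * (k / (c - τ)) + k / γ) * (k / (c - τ))) * (k / (c - τ)) := by ring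
      rw [this]
      gcongr
    · exact ⟨0, le_rfl, fun u => by simp⟩
  obtain ⟨C₁, h₁, hC₁⟩ := hshort
  obtain ⟨C₂, h₂, hC₂⟩ := hlong
  -- The summand 1 only serves to make the constant strictly positive.
  refine ⟨(C₂ + ∑ j, |α j| * C₁ + 1) ^ 2, by positivity, fun u => ?_⟩
  have hk := quad_nonneg hσ hτ hγ u
  have hb : |cubic β α u| ≤ (C₂ + ∑ j, |α j| * C₁ + 1) * √(quad c σ τ γ u ^ 3) := by
    calc |cubic β α u| ≤ |1 / 3 * β * tri u.2 u.2 u.2| +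
          ∑ j, |α j * tri (u.1 j) (u.1 j) u.2| :=
          (abs_add_le _ _).trans (add_le_add le_rfl (Finset.abs_sum_le_sum_abs _ _))
      _ ≤ C₂ * √(quad c σ τ γ u ^ 3) + ∑ j, |α j| * C₁ * √(quad c σ τ γ u ^ 3) := by
          refine add_le_add (hC₂ u) (Finset.sum_le_sum fun j _ => ?_)
          rw [abs_mul, mul_assoc]
          exact mul_le_mul_of_nonneg_left (hC₁ u j) (abs_nonneg _)
      _ ≤ _ := by
          rw [← Finset.sum_mul]
          linarith [Real.sqrt_nonneg (quad c σ τ γ u ^ 3)]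
  calc cubic β α u ^ 2 = |cubic β α u| ^ 2 := (sq_abs _).symm
    _ ≤ ((C₂ + ∑ j, |α j| * C₁ + 1) * √(quad c σ τ γ u ^ 3)) ^ 2 := by gcongr
    _ = _ := by rw [mul_pow, Real.sq_sqrt (by positivity)]

/-- Rules out vanishing: every term of the density contains a factor g, and what remains is
quadratic and controlled by the energy. -/
theorem cubic_le_of_abs_fn_le (hσ : 0 < σ) (hτ : τ < c) (hγ : 0 ≤ γ) :
    ∃ C, 0 ≤ C ∧ ∀ (u : Tuple N) (S : ℝ), (∀ x, |u.2.fn x| ≤ S) →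
      cubic β α u ≤ S * (C * quad c σ τ γ u) := by
  have hτ' : 0 < c - τ := sub_pos.2 hτ
  refine ⟨|1 / 3 * β| * (1 / (c - τ)) + ∑ j, |α j| * (1 / σ), by positivity, fun u S hS => ?_⟩
  have hS0 : 0 ≤ S := (abs_nonneg _).trans (hS 0)
  calc cubic β α u ≤ |cubic β α u| := le_abs_self _
    _ ≤ |1 / 3 * β * tri u.2 u.2 u.2| + ∑ j, |α j * tri (u.1 j) (u.1 j) u.2| :=
        (abs_add_le _ _).trans (add_le_add le_rfl (Finset.abs_sum_le_sum_abs _ _))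
    _ ≤ |1 / 3 * β| * (S * (quad c σ τ γ u / (c - τ))) +
        ∑ j, |α j| * (S * (quad c σ τ γ u / σ)) := by
        simp only [abs_mul (1 / 3 * β), abs_mul (α _)]
        refine add_le_add ?_ (Finset.sum_le_sum fun j _ => ?_)
        · exact mul_le_mul_of_nonneg_left ((abs_tri_self_le _ _ hS).trans
            (mul_le_mul_of_nonneg_left (ip_long_le hσ hτ hγ u) hS0)) (abs_nonneg _)
        · exact mul_le_mul_of_nonneg_left ((abs_tri_self_le _ _ hS).trans
            (mul_le_mul_of_nonneg_left (ip_short_le hσ hτ hγ u j) hS0)) (abs_nonneg _)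
    _ = _ := by
        simp only [← Finset.sum_mul]
        ring

theorem exists_cube_eq (x : ℝ) : ∃ s : ℝ, s ^ 3 = x := by
  have key : ∀ y : ℝ, 0 ≤ y → ∃ s : ℝ, s ^ 3 = y := fun y hy =>
    ⟨y ^ (((3 : ℕ) : ℝ)⁻¹), Real.rpow_inv_natCast_pow hy (by norm_num)⟩
  rcases le_total 0 x with h | h
  · exact key x h
  · obtain ⟨s, hs⟩ := key (-x) (by linarith)
    exact ⟨-s, by linear_combination -hs⟩

/-- A lower bound on a level set extends to all tuples by homogeneity. -/
theorem cube_mul_sq_cubic_le (hσ : 0 < σ) (hτ : τ < c) (hγ : 0 ≤ γ) {lam M : ℝ} (hM : 0 ≤ M)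
    (hmin : ∀ u : Tuple N, cubic β α u = lam → M ≤ quad c σ τ γ u) (u : Tuple N) :
    M ^ 3 * cubic β α u ^ 2 ≤ quad c σ τ γ u ^ 3 * lam ^ 2 := by
  have hk := quad_nonneg hσ hτ hγ u
  by_cases h0 : cubic β α u = 0
  · rw [h0]; simp only [ne_eq, OfNat.ofNat_ne_zero, not_false_eq_true, zero_pow, mul_zero]
    positivity
  -- The degree is odd, so a real scaling factor exists whatever the sign of the constraint value;
  -- the remainders of the splitting come without a known sign.
  obtain ⟨s, hs⟩ : ∃ s : ℝ, s ^ 3 = lam / cubic β α u := exists_cube_eq _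
  have h1 : s ^ 3 * cubic β α u = lam := by rw [hs]; field_simp
  have h2 := hmin (s • u) (by rw [cubic_smul, h1])
  rw [quad_smul] at h2
  have h3 : M ^ 3 ≤ (s ^ 2 * quad c σ τ γ u) ^ 3 := by gcongr
  calc M ^ 3 * cubic β α u ^ 2 ≤ (s ^ 2 * quad c σ τ γ u) ^ 3 * cubic β α u ^ 2 := by gcongr
    _ = quad c σ τ γ u ^ 3 * (s ^ 3 * cubic β α u) ^ 2 := by ring
    _ = _ := by rw [h1]

end Bounds

end LSI

end VariationalProblem

/-! ### Existence of minimizers. -/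

section Existence
open Set Filter Topology

namespace LSI
open H1

variable {N : ℕ} {c σ τ β γ lam : ℝ} {α : Fin N → ℝ}

/-- With one bump in all components the functional is positive, and scaling by a cube root reaches
any value. -/
theorem exists_cubic_eq (hN : 1 ≤ N) (hβ : 0 ≤ β) (hα : ∀ j, 0 < α j) (lam : ℝ) :
    ∃ u : Tuple N, cubic β α u = lam := by
  let b : ContDiffBump (0 : ℝ) := default
  let η : H1 := ofContDiff b.contDiff b.hasCompactSupport
  have hη : 0 < tri η η η := by
    have hb : Continuous fun x => b x * b x * b x := (b.continuous.mul b.continuous).mul b.continuous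
    refine integral_pos_of_integrable_nonneg_nonzero (x := 0) hb (integrable_tri η η η)
      (fun x => mul_nonneg (mul_self_nonneg _) b.nonneg) ?_
    have : b 0 = 1 := b.one_of_mem_closedBall (by simp [b.rIn_pos.le])
    simp [η, ofContDiff, this]
  have hpos : 0 < cubic β α ((fun _ => η, η) : Tuple N) := by
    simp only [cubic, ← Finset.sum_mul]
    have : 0 < ∑ j, α j := Finset.sum_pos (fun j _ => hα j) ⟨⟨0, hN⟩, Finset.mem_univ _⟩
    positivity
  obtain ⟨s, hs⟩ := exists_cube_eq (lam / cubic β α ((fun _ => η, η) : Tuple N))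
  exact ⟨s • (fun _ => η, η), by rw [cubic_smul, hs]; field_simp⟩

/-- Controls the derivative of ∑ αⱼfⱼ² by the H¹ norms of the fⱼ, through (f²)' = 2ff' and the sup
bound. This supplies the missing derivative bound for the last component when γ = 0. -/
theorem exists_ipd_sum_smul_sq_le (α : Fin N → ℝ) (T : ℝ) (s : Finset (Fin N)) :
    ∃ B, ∀ f : Fin N → H1, (∀ j, ip (f j) (f j) ≤ T ∧ ipd (f j) (f j) ≤ T) →
      ipd (∑ j ∈ s, α j • (f j).sq) (∑ j ∈ s, α j • (f j).sq) ≤ B := by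
  classical
  induction s using Finset.induction_on with
  | empty => exact ⟨0, fun f _ => by simp [ipd]⟩
  | insert i s hi ih =>
    obtain ⟨B, hB⟩ := ih
    refine ⟨2 * (α i ^ 2 * (4 * (2 * T + T) * T)) + 2 * B, fun f hf => ?_⟩
    rw [Finset.sum_insert hi]
    refine (ipd_add_self_le _ _).trans ?_
    have h1 := hB f hf
    have h2 : ipd (f i).sq (f i).sq ≤ 4 * (2 * T + T) * T := by
      refine (ipd_sq_le (f i)).trans ?_
      have := ip_self_nonneg (f i)
      have := ipd_self_nonneg (f i)
      have := (hf i).1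
      have := (hf i).2
      gcongr
      linarith
    rw [ipd_smul_left, ipd_smul_right]
    have h3 := mul_le_mul_of_nonneg_left h2 (sq_nonneg (α i))
    linarith

theorem ip_sum_left {ι : Type*} (s : Finset ι) (f : ι → H1) (v : H1) :
    ip (∑ i ∈ s, f i) v = ∑ i ∈ s, ip (f i) v := by
  classical
  induction s using Finset.induction_on with
  | empty => simp [ip]
  | insert i s hi ih => rw [Finset.sum_insert hi, Finset.sum_insert hi, ip_add_left, ih]

/-- Tuples in the constraint set can be replaced by tuples of no larger energy whose `H¹` norms
are controlled by the energy. For `γ = 0` the energy does not control the derivative of the last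
component, which is then replaced by the optimal one. -/
theorem exists_replacement (hσ : 0 < σ) (hτ : τ < c) (hγ : 0 ≤ γ) (hγβ : 0 < γ ∨ β = 0)
    (hlam : 0 < lam) (T : ℝ) :
    ∃ B, ∀ u : Tuple N, cubic β α u = lam → quad c σ τ γ u ≤ T →
      ∃ v : Tuple N, cubic β α v = lam ∧ quad c σ τ γ v ≤ quad c σ τ γ u ∧
        (∀ j, ip (v.1 j) (v.1 j) ≤ B ∧ ipd (v.1 j) (v.1 j) ≤ B) ∧
        ip v.2 v.2 ≤ B ∧ ipd v.2 v.2 ≤ B := by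
  have hτ' : 0 < c - τ := sub_pos.2 hτ
  rcases hγ.lt_or_eq with hγ' | rfl
  · refine ⟨max (max (T / σ) T) (max (T / (c - τ)) (T / γ)), fun u hu hT =>
      ⟨u, hu, le_rfl, fun j => ⟨?_, ?_⟩, ?_, ?_⟩⟩
    · exact le_max_of_le_left (le_max_of_le_left ((ip_short_le hσ hτ hγ u j).trans (by gcongr)))
    · exact le_max_of_le_left (le_max_of_le_right ((ipd_short_le hσ hτ hγ u j).trans hT))
    · exact le_max_of_le_right (le_max_of_le_left ((ip_long_le hσ hτ hγ u).trans (by gcongr)))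
    · exact le_max_of_le_right (le_max_of_le_right ((ipd_long_le hσ hτ hγ' u).trans (by gcongr)))
  · obtain rfl : β = 0 := hγβ.resolve_left (lt_irrefl _)
    obtain ⟨D, hD⟩ := exists_ipd_sum_smul_sq_le α (max (T / σ) T) Finset.univ
    refine ⟨max (max (T / σ) T) (max (T / (c - τ)) ((T / (c - τ) / lam) ^ 2 * D)),
      fun u hu hT => ?_⟩
    -- For β = 0 the constraint on g is ⟨G, g⟩ = λ. By Cauchy-Schwarz its solution of least L² norm
    -- is s G with s = λ/‖G‖², and for γ = 0 only this norm of g enters the energy.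
    let G : H1 := ∑ j, α j • (u.1 j).sq
    have hcub : ∀ g : H1, cubic 0 α ((u.1, g) : Tuple N) = ip G g := fun g => by
      simp only [cubic, G, ip_sum_left, ip_smul_left, tri_eq_ip_sq]
      ring
    have hG : ip G u.2 = lam := by rw [← hcub]; exact hu
    have hGs : lam ^ 2 ≤ ip G G * ip u.2 u.2 := by
      have := sq_integral_mul_le G.memLp_fn u.2.memLp_fn
      simp only [pow_two (G.fn _), pow_two (u.2.fn _)] at this
      rw [← hG]; exact this
    have hf : ∀ j, ip (u.1 j) (u.1 j) ≤ max (T / σ) T ∧ ipd (u.1 j) (u.1 j) ≤ max (T / σ) T :=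
      fun j => ⟨le_max_of_le_left ((ip_short_le hσ hτ hγ u j).trans (by gcongr)),
        le_max_of_le_right ((ipd_short_le hσ hτ hγ u j).trans hT)⟩
    have hg : ip u.2 u.2 ≤ T / (c - τ) := (ip_long_le hσ hτ hγ u).trans (by gcongr)
    have hGD : ipd G G ≤ D := hD u.1 hf
    have hGpos : 0 < ip G G := by
      refine lt_of_le_of_ne G.ip_self_nonneg fun h => ?_
      rw [← h] at hGs
      nlinarith
    set s := lam / ip G G with hs
    have hs0 : 0 < s := div_pos hlam hGpos
    have hsG : s * ip G G = lam := div_mul_cancel₀ _ hGpos.ne'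
    have hnorm : ip (s • G) (s • G) ≤ ip u.2 u.2 := by
      rw [ip_smul_left, ip_smul_right, hsG]
      rw [hs, div_mul_eq_mul_div, div_le_iff₀ hGpos]
      nlinarith
    refine ⟨(u.1, s • G), ?_, ?_, fun j => ⟨?_, ?_⟩, ?_, ?_⟩
    · rw [hcub, ip_smul_right, hsG]
    · simp only [quad, zero_mul, zero_add]
      gcongr
    · exact le_max_of_le_left (hf j).1
    · exact le_max_of_le_left (hf j).2
    · exact le_max_of_le_right (le_max_of_le_left (hnorm.trans hg))
    · refine le_max_of_le_right (le_max_of_le_right ?_)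
      have h1 : ip (s • G) (s • G) = s * lam := by rw [ip_smul_left, ip_smul_right, hsG]
      -- The identity ‖s G‖² = s λ turns the L² bound into a bound on s, without a separate lower
      -- bound for ‖G‖.
      have h2 : s ≤ T / (c - τ) / lam := by
        rw [le_div_iff₀ hlam, ← h1]
        exact hnorm.trans hg
      change ipd (s • G) (s • G) ≤ _
      rw [ipd_smul_left, ipd_smul_right, ← mul_assoc, ← pow_two]
      have := G.ipd_self_nonneg
      gcongr

theorem tendsto_quad_sub {u : ℕ → Tuple N} {v : Tuple N}
    (h1 : ∀ j, WeakConv (fun n => (u n).1 j) (v.1 j)) (h2 : WeakConv (fun n => (u n).2) v.2) :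
    Tendsto (fun n => quad c σ τ γ (u n) - quad c σ τ γ (u n - v)) atTop
      (𝓝 (quad c σ τ γ v)) := by
  have hs := tendsto_finsetSum Finset.univ fun j _ =>
    (h1 j).tendsto_ipd_sub.add ((h1 j).tendsto_ip_sub.const_mul σ)
  have := hs.add ((h2.tendsto_ipd_sub.const_mul γ).add (h2.tendsto_ip_sub.const_mul (c - τ)))
  refine this.congr fun n => ?_
  simp only [quad, Prod.fst_sub, Prod.snd_sub, Pi.sub_apply, Finset.sum_add_distrib,
    ← Finset.mul_sum, Finset.sum_sub_distrib]
  ring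

theorem tendsto_cubic_sub {u : ℕ → Tuple N} {v : Tuple N}
    (h1 : ∀ j, WeakConv (fun n => (u n).1 j) (v.1 j)) (h2 : WeakConv (fun n => (u n).2) v.2) :
    Tendsto (fun n => cubic β α (u n) - cubic β α (u n - v)) atTop (𝓝 (cubic β α v)) := by
  have hs := tendsto_finsetSum Finset.univ fun j _ =>
    ((h1 j).tendsto_tri_sub (h1 j) h2).const_mul (α j)
  have := ((h2.tendsto_tri_sub h2 h2).const_mul (1 / 3 * β)).add hs
  refine this.congr fun n => ?_
  simp only [cubic, Prod.fst_sub, Prod.snd_sub, Pi.sub_apply, mul_sub, Finset.sum_sub_distrib]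
  ring

/-- Excludes splitting of the mass. In normalized variables s ≤ X^(3/2) ≤ X and 1 - s ≤ (1 -
X)^(3/2) ≤ 1 - X; hence s = X, and then X² ≤ X³ with 0 < X ≤ 1 leaves X = 1. -/
theorem eq_of_cube_le {M lam x a : ℝ} (hM : 0 < M) (hlam : 0 < lam) (hx : 0 < x) (hxM : x ≤ M)
    (h1 : M ^ 3 * a ^ 2 ≤ x ^ 3 * lam ^ 2)
    (h2 : M ^ 3 * (lam - a) ^ 2 ≤ (M - x) ^ 3 * lam ^ 2) : a = lam ∧ x = M := by
  obtain ⟨X, rfl⟩ : ∃ X, x = X * M := ⟨x / M, by field_simp⟩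
  obtain ⟨s, rfl⟩ : ∃ s, a = s * lam := ⟨a / lam, by field_simp⟩
  have hX : 0 < X := pos_of_mul_pos_left hx hM.le
  have hX1 : X ≤ 1 := by nlinarith
  have hp : 0 < M ^ 3 * lam ^ 2 := by positivity
  have e1 : s ^ 2 ≤ X ^ 3 := by
    refine le_of_mul_le_mul_left ?_ hp
    linarith
  have e2 : (1 - s) ^ 2 ≤ (1 - X) ^ 3 := by
    refine le_of_mul_le_mul_left ?_ hp
    linarith
  have e3 : s ≤ X := abs_le_of_sq_le_sq' (by nlinarith [sq_nonneg X]) hX.le |>.2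
  have e4 : 1 - s ≤ 1 - X :=
    abs_le_of_sq_le_sq' (by nlinarith [sq_nonneg (1 - X)]) (by linarith) |>.2
  obtain rfl : s = X := by linarith
  have : s = 1 := by
    have : 1 ≤ s := by
      by_contra! h
      nlinarith [sq_pos_of_pos hX]
    linarith
  subst this
  simp

theorem exists_tuple_isMin (hN : 1 ≤ N) (hσ : 0 < σ) (hτ : τ < c) (hβ : 0 ≤ β) (hγ : 0 ≤ γ)
    (hα : ∀ j, 0 < α j) (hγβ : 0 < γ ∨ β = 0) (hlam : 0 < lam) :
    ∃ u : Tuple N, cubic β α u = lam ∧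
      ∀ v : Tuple N, cubic β α v = lam → quad c σ τ γ u ≤ quad c σ τ γ v := by
  let S : Set ℝ := {k | ∃ u : Tuple N, cubic β α u = lam ∧ quad c σ τ γ u = k}
  have hSb : BddBelow S := ⟨0, fun k ⟨u, _, hu⟩ => hu ▸ quad_nonneg hσ hτ hγ u⟩
  have hSn : S.Nonempty := by
    obtain ⟨u, hu⟩ := exists_cubic_eq (β := β) (α := α) hN hβ hα lam
    exact ⟨_, u, hu, rfl⟩
  obtain ⟨M, hM⟩ : ∃ M, M = sInf S := ⟨_, rfl⟩
  have hmin : ∀ v : Tuple N, cubic β α v = lam → M ≤ quad c σ τ γ v := fun v hv =>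
    hM ▸ csInf_le hSb ⟨v, hv, rfl⟩
  have hM0 : 0 ≤ M := hM ▸ le_csInf hSn fun k ⟨u, _, hu⟩ => hu ▸ quad_nonneg hσ hτ hγ u
  obtain ⟨k, -, hkM, hkS⟩ := exists_seq_tendsto_sInf hSn hSb
  rw [← hM] at hkM
  choose u₀ hu₀ hk using hkS
  obtain ⟨T, hT⟩ := hkM.bddAbove_range
  have hT' : ∀ n, k n ≤ T := fun n => hT (mem_range_self n)
  obtain ⟨B, hB⟩ := exists_replacement (N := N) (α := α) hσ hτ hγ hγβ hlam T
  choose u₁ hu₁ hq₁ hs₁ hl₁ using fun n => hB (u₀ n) (hu₀ n) (hk n ▸ hT' n)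
  have hq₁M : Tendsto (fun n => quad c σ τ γ (u₁ n)) atTop (𝓝 M) :=
    tendsto_of_tendsto_of_tendsto_of_le_of_le tendsto_const_nhds hkM
      (fun n => hmin _ (hu₁ n)) (fun n => (hq₁ n).trans (hk n).le)
  obtain ⟨C, hC0, hC⟩ := exists_sq_cubic_le (N := N) (α := α) hσ hτ hγ hγβ
  have hMpos : 0 < M := by
    have h : lam ^ 2 ≤ C * M ^ 3 := ge_of_tendsto' ((hq₁M.pow 3).const_mul C) fun n => by
      simpa only [hu₁ n] using hC (u₁ n)
    refine lt_of_le_of_ne hM0 fun h0 => ?_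
    rw [← h0] at h
    norm_num at h
    exact hlam.ne' h
  obtain ⟨C', hC'0, hC'⟩ := cubic_le_of_abs_fn_le (N := N) (β := β) (α := α) (σ := σ) (τ := τ)
    (c := c) (γ := γ) hσ hτ hγ
  have hTpos : 0 ≤ T := hM0.trans ((hmin _ (hu₀ 0)).trans (hk 0 ▸ hT' 0))
  -- Small enough that a last component below δ everywhere would give a constraint value below λ.
  obtain ⟨δ, hδ⟩ : ∃ δ, δ = lam / (2 * (C' * T + 1)) := ⟨_, rfl⟩
  have hδ0 : 0 < δ := by rw [hδ]; positivity
  have hpeak : ∀ n, ∃ x, δ ≤ |(u₁ n).2.fn x| := by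
    intro n
    by_contra! h
    have h1 := hC' (u₁ n) δ fun x => (h x).le
    have h2 : quad c σ τ γ (u₁ n) ≤ T := (hq₁ n).trans (hk n ▸ hT' n)
    have h3 : C' * quad c σ τ γ (u₁ n) ≤ C' * T := by gcongr
    have h4 : δ * (2 * (C' * T + 1)) = lam := by rw [hδ]; field_simp
    rw [hu₁ n] at h1
    nlinarith [mul_le_mul_of_nonneg_left h3 hδ0.le, mul_nonneg hC'0 hTpos]
  choose y hy using hpeak
  let u₂ : ℕ → Tuple N := fun n => (u₁ n).shift (y n)
  -- Indexing by `Option` extracts a common subsequence for all N + 1 components, with `none`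
  -- standing for the last one.
  let w : Option (Fin N) → ℕ → H1 := fun i n => i.elim (u₂ n).2 (u₂ n).1
  obtain ⟨v, φ, hφ, hv⟩ := exists_subseq_weakConv_pi (u := w) (B := B) (by
    rintro (_ | j) n
    · simpa [w, u₂, Tuple.shift, ip_shift, ipd_shift] using hl₁ n
    · simpa [w, u₂, Tuple.shift, ip_shift, ipd_shift] using hs₁ n j)
  let V : Tuple N := (fun j => v (some j), v none)
  let U : ℕ → Tuple N := fun n => u₂ (φ n)
  have h1 : ∀ j, WeakConv (fun n => (U n).1 j) (V.1 j) := fun j => hv (some j)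
  have h2 : WeakConv (fun n => (U n).2) V.2 := hv none
  have hUlam : ∀ n, cubic β α (U n) = lam := fun n => (cubic_shift _ _ _ _).trans (hu₁ _)
  have hUM : Tendsto (fun n => quad c σ τ γ (U n)) atTop (𝓝 M) := by
    refine (hq₁M.comp hφ.tendsto_atTop).congr fun n => ?_
    exact (quad_shift _ _ _ _ _ _).symm
  -- The peaks were moved to the origin, and weak convergence in H¹ is pointwise, so the limit is
  -- nonzero.
  have hV0 : δ ≤ |V.2.fn 0| := by
    refine ge_of_tendsto' (h2.pointwise 0).abs fun n => ?_
    simpa [U, u₂, Tuple.shift] using hy (φ n)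
  have hVpos : 0 < quad c σ τ γ V := by
    have := ip_self_pos (abs_pos.1 (hδ0.trans_le hV0))
    have h3 := long_le_quad (c := c) (τ := τ) (γ := γ) hσ V
    have h4 := mul_nonneg hγ (ipd_self_nonneg V.2)
    have h5 := mul_pos (sub_pos.2 hτ) this
    linarith
  have hR : Tendsto (fun n => quad c σ τ γ (U n - V)) atTop (𝓝 (M - quad c σ τ γ V)) := by
    simpa using hUM.sub (tendsto_quad_sub (c := c) (σ := σ) (τ := τ) (γ := γ) h1 h2)
  have hA : Tendsto (fun n => cubic β α (U n - V)) atTop (𝓝 (lam - cubic β α V)) := by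
    have := (tendsto_const_nhds (x := lam)).sub (tendsto_cubic_sub (β := β) (α := α) h1 h2)
    refine this.congr fun n => ?_
    rw [hUlam]; ring
  have hVM : quad c σ τ γ V ≤ M := by
    have := ge_of_tendsto' hR fun n => quad_nonneg hσ hτ hγ (U n - V)
    linarith
  have hineq := cube_mul_sq_cubic_le hσ hτ hγ hM0 hmin
  -- The homogeneous inequality for the remainders, in the limit.
  have hlim := le_of_tendsto_of_tendsto' ((hA.pow 2).const_mul (M ^ 3))
    ((hR.pow 3).mul_const (lam ^ 2)) fun n => hineq (U n - V)
  obtain ⟨e1, e2⟩ := eq_of_cube_le hMpos hlam hVpos hVM (hineq V) hlim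
  exact ⟨V, e1, fun z hz => e2 ▸ hmin z hz⟩

theorem exists_isMinimizer (hN : 1 ≤ N) (hσ : 0 < σ) (hτ : τ < c) (hβ : 0 ≤ β) (hγ : 0 ≤ γ)
    (hα : ∀ j, 0 < α j) (hγβ : 0 < γ ∨ β = 0) (hlam : 0 < lam) :
    ∃ p, IsMinimizer c σ τ β γ α lam p := by
  obtain ⟨u, hu, hmin⟩ := exists_tuple_isMin hN hσ hτ hβ hγ hα hγβ hlam
  refine ⟨u.toFun, toFun_mem_admissible.2 hu, fun p hp => ?_⟩
  obtain ⟨v, hv1, hv2, hd1, hd2⟩ := exists_tuple hp.1 hp.2.1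
  change energy c σ τ γ u.toFun ≤ energy c σ τ γ p
  rw [energy_toFun, energy_eq_quad c σ τ γ hv1 hv2 hd1 hd2]
  refine hmin v ?_
  rw [← integral_density_eq_cubic β α hv1 hv2]
  exact hp.2.2

end LSI

end Existence

/-! ### Euler-Lagrange equation and classical form of the profile system. -/

section EulerLagrange
open Set Filter Topology

/-- The hypothesis says that the derivative of u has the continuous weak derivative r. Its
representative F is then a primitive of r, and u, being a primitive of the continuous F, is twice
differentiable. -/
theorem H1.exists_hasDerivAt_of_weak (u : H1) {r : ℝ → ℝ} (hr : Continuous r)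
    (h : ∀ (φ : ℝ → ℝ) (hφ : ContDiff ℝ ∞ φ) (hc : HasCompactSupport φ),
      H1.ipd u (H1.ofContDiff hφ hc) = -∫ x, r x * φ x) :
    ∃ F : ℝ → ℝ, (∀ x, HasDerivAt u.fn (F x) x) ∧ (∀ x, HasDerivAt F (r x) x) ∧
      u.dv =ᵐ[volume] F := by
  have hw : IsWeakDeriv u.dv r :=
    ⟨u.isPrimitive.locallyIntegrable, hr.locallyIntegrable, fun φ hφ hc => h φ hφ hc⟩
  obtain ⟨F, hF, hp⟩ := hw.exists_isPrimitive
  exact ⟨F, (u.isPrimitive.congr_ae hF).hasDerivAt hp.continuous, hp.hasDerivAt hr, hF⟩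

/-- Both u² and its derivative 2uu' are integrable, so u² tends to 0 at both ends. -/
theorem H1.tendsto_fn_sq (u : H1) {F : ℝ → ℝ} (hF : ∀ x, HasDerivAt u.fn (F x) x)
    (hae : u.dv =ᵐ[volume] F) : Tendsto (fun x => u.fn x ^ 2) (cocompact ℝ) (𝓝 0) := by
  have hd : ∀ x, HasDerivAt (fun x => u.fn x ^ 2) (2 * (u.fn x * F x)) x := fun x => by
    refine ((hF x).pow 2).congr_deriv ?_
    ring
  have hi : Integrable fun x => 2 * (u.fn x * F x) :=
    ((u.integrable_fn_mul_dv u).congr (hae.mono fun x hx => by simp only [hx])).const_mul 2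
  have hi2 := u.memLp_fn.integrable_sq
  rw [cocompact_eq_atBot_atTop]
  exact Tendsto.sup
    (tendsto_zero_of_hasDerivAt_of_integrableOn_Iic (a := 0) (fun x _ => hd x) hi.integrableOn
      hi2.integrableOn)
    (tendsto_zero_of_hasDerivAt_of_integrableOn_Ioi (a := 0) (fun x _ => hd x) hi.integrableOn
      hi2.integrableOn)

namespace LSI
open H1

variable {N : ℕ} {c σ τ β γ lam : ℝ} {α : Fin N → ℝ}

theorem quad_pos (hσ : 0 < σ) (hτ : τ < c) (hγ : 0 ≤ γ) (hγβ : 0 < γ ∨ β = 0) (hlam : 0 < lam)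
    {u : Tuple N} (hu : cubic β α u = lam) : 0 < quad c σ τ γ u := by
  obtain ⟨C, -, hC⟩ := exists_sq_cubic_le (N := N) (α := α) hσ hτ hγ hγβ
  refine lt_of_le_of_ne (quad_nonneg hσ hτ hγ u) fun h0 => ?_
  have h := hC u
  rw [hu, ← h0] at h
  norm_num at h
  exact hlam.ne' h

/-- The homogeneous inequality removes the constraint: K(u+th)³λ² - K(u)³A(u+th)² is a nonnegative
polynomial in t that vanishes at t = 0, so its derivative there is zero. No multiplier theorem is
needed. -/
theorem bil_eq_of_isMin (hσ : 0 < σ) (hτ : τ < c) (hγ : 0 ≤ γ) (hγβ : 0 < γ ∨ β = 0)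
    (hlam : 0 < lam) {u : Tuple N} (hu : cubic β α u = lam)
    (hmin : ∀ v : Tuple N, cubic β α v = lam → quad c σ τ γ u ≤ quad c σ τ γ v) (h : Tuple N) :
    bil c σ τ γ u h = quad c σ τ γ u / (3 * lam) * dcubic β α u h := by
  have hM := quad_pos hσ hτ hγ hγβ hlam hu
  have hineq := cube_mul_sq_cubic_le hσ hτ hγ hM.le hmin
  obtain ⟨D, hD⟩ := cubic_add_smul β α u h
  let P : ℝ → ℝ := fun t => (quad c σ τ γ u + 2 * t * bil c σ τ γ u h +
    t ^ 2 * quad c σ τ γ h) ^ 3 * lam ^ 2 - quad c σ τ γ u ^ 3 *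
    (lam + t * dcubic β α u h + t ^ 2 * D + t ^ 3 * cubic β α h) ^ 2
  have hP0 : P 0 = 0 := by simp only [P]; ring
  have hP : ∀ t, 0 ≤ P t := fun t => by
    have := hineq (u + t • h)
    rw [quad_add_smul, hD, hu] at this
    simp only [P]
    linarith
  have hq : HasDerivAt (fun t : ℝ => quad c σ τ γ u + 2 * t * bil c σ τ γ u h +
      t ^ 2 * quad c σ τ γ h) (2 * bil c σ τ γ u h) 0 := by
    have h1 := (((hasDerivAt_id (0 : ℝ)).const_mul 2).mul_const (bil c σ τ γ u h)).const_add
      (quad c σ τ γ u)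
    have h2 := ((hasDerivAt_id (0 : ℝ)).pow 2).mul_const (quad c σ τ γ h)
    refine (h1.add h2).congr_deriv ?_
    simp
  have ha : HasDerivAt (fun t : ℝ => lam + t * dcubic β α u h + t ^ 2 * D +
      t ^ 3 * cubic β α h) (dcubic β α u h) 0 := by
    have h1 := ((hasDerivAt_id (0 : ℝ)).mul_const (dcubic β α u h)).const_add lam
    have h2 := ((hasDerivAt_id (0 : ℝ)).pow 2).mul_const D
    have h3 := ((hasDerivAt_id (0 : ℝ)).pow 3).mul_const (cubic β α h)
    refine ((h1.add h2).add h3).congr_deriv ?_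
    simp
  have hPd := ((hq.pow 3).mul_const (lam ^ 2)).sub ((ha.pow 2).const_mul (quad c σ τ γ u ^ 3))
  have hloc : IsLocalMin P 0 := Eventually.of_forall fun t => by rw [hP0]; exact hP t
  have hz := hloc.hasDerivAt_eq_zero hPd
  simp at hz
  have h3 : quad c σ τ γ u ^ 2 * lam * (3 * lam * bil c σ τ γ u h -
      quad c σ τ γ u * dcubic β α u h) = 0 := by linarith
  have h4 := (mul_eq_zero.1 h3).resolve_left (by positivity)
  field_simp
  linarith

/-- The classical first order form of the solitary wave system. -/
structure IsClassical (c σ τ β γ : ℝ) (α : Fin N → ℝ) (Φ Φ₁ : Fin N → ℝ → ℝ)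
    (Ψ Ψ₁ Ψ₂ : ℝ → ℝ) : Prop where
  short : ∀ j x, HasDerivAt (Φ j) (Φ₁ j x) x
  short' : ∀ j x, HasDerivAt (Φ₁ j) (σ * Φ j x - α j * Φ j x * Ψ x) x
  long : ∀ x, HasDerivAt Ψ (Ψ₁ x) x
  long' : ∀ x, HasDerivAt Ψ₁ (Ψ₂ x) x
  eq : ∀ x, γ * Ψ₂ x = (c - τ) * Ψ x - 1 / 2 * β * Ψ x ^ 2 - 1 / 2 * ∑ j, α j * Φ j x ^ 2

theorem weak_short {κ : ℝ} {u : Tuple N}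
    (hEL : ∀ h, bil c σ τ γ u h = κ / 2 * dcubic β α u h) (j : Fin N) (η : H1) :
    ipd (u.1 j) η = -∫ x, (σ * (u.1 j).fn x - κ * α j * ((u.1 j).fn x * u.2.fn x)) * η.fn x := by
  have h := hEL (Pi.single j η, 0)
  have hb : bil c σ τ γ u (Pi.single j η, 0) = ipd (u.1 j) η + σ * ip (u.1 j) η := by
    simp only [bil]
    rw [Finset.sum_eq_single j]
    · simp [ip, ipd]
    · intro i _ hi
      simp [Pi.single_eq_of_ne hi, ip, ipd]
    · simp
  have hd : dcubic β α u (Pi.single j η, 0) = α j * (2 * tri (u.1 j) u.2 η) := by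
    simp only [dcubic]
    rw [Finset.sum_eq_single j]
    · simp [tri]
    · intro i _ hi
      simp [Pi.single_eq_of_ne hi, tri]
    · simp
  rw [hb, hd] at h
  have e : ∫ x, (σ * (u.1 j).fn x - κ * α j * ((u.1 j).fn x * u.2.fn x)) * η.fn x =
      σ * ip (u.1 j) η - κ * α j * tri (u.1 j) u.2 η := by
    simp only [sub_mul, mul_assoc σ, mul_assoc (κ * α j)]
    rw [integral_sub ((integrable_fn_mul _ _).const_mul _) ((integrable_tri _ _ _).const_mul _),
      integral_const_mul, integral_const_mul]
    rfl
  rw [e]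
  linarith

theorem weak_long {κ : ℝ} {u : Tuple N}
    (hEL : ∀ h, bil c σ τ γ u h = κ / 2 * dcubic β α u h) (η : H1) :
    γ * ipd u.2 η = -∫ x, ((c - τ) * u.2.fn x - κ / 2 * (β * (u.2.fn x * u.2.fn x) +
      ∑ j, α j * ((u.1 j).fn x * (u.1 j).fn x))) * η.fn x := by
  have h := hEL (0, η)
  have hb : bil c σ τ γ u (0, η) = γ * ipd u.2 η + (c - τ) * ip u.2 η := by
    simp [bil, ip, ipd]
  have hd : dcubic β α u (0, η) = β * tri u.2 u.2 η + ∑ j, α j * tri (u.1 j) (u.1 j) η := by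
    simp [dcubic, tri]
  rw [hb, hd] at h
  have e : ∀ x, ((c - τ) * u.2.fn x - κ / 2 * (β * (u.2.fn x * u.2.fn x) +
      ∑ j, α j * ((u.1 j).fn x * (u.1 j).fn x))) * η.fn x =
      (c - τ) * (u.2.fn x * η.fn x) - κ / 2 * (β * (u.2.fn x * u.2.fn x * η.fn x) +
      ∑ j, α j * ((u.1 j).fn x * (u.1 j).fn x * η.fn x)) := fun x => by
    simp only [← mul_assoc, ← Finset.sum_mul]
    ring
  have i1 : Integrable fun x => ∑ j, α j * ((u.1 j).fn x * (u.1 j).fn x * η.fn x) :=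
    integrable_finsetSum _ fun j _ => (integrable_tri _ _ _).const_mul _
  have i2 : Integrable fun x => β * (u.2.fn x * u.2.fn x * η.fn x) :=
    (integrable_tri _ _ _).const_mul _
  have i3 : Integrable fun x => κ / 2 * (β * (u.2.fn x * u.2.fn x * η.fn x) +
      ∑ j, α j * ((u.1 j).fn x * (u.1 j).fn x * η.fn x)) := (i2.add i1).const_mul _
  simp only [e]
  rw [integral_sub ((integrable_fn_mul _ _).const_mul _) i3,
    integral_const_mul, integral_const_mul, integral_add i2 i1, integral_const_mul,
    integral_finsetSum _ fun j _ => (integrable_tri _ _ _).const_mul _]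
  simp only [integral_const_mul]
  simp only [ip, ipd, tri] at h ⊢
  linarith

/-- Multiplication by κ absorbs the multiplier, since the linear terms scale by κ and the quadratic
ones by κ². For γ = 0 the last equation is algebraic; it expresses Ψ through the Φⱼ, and the
derivatives of Ψ are then read off from the short-wave equations. -/
theorem exists_isClassical (hτ : τ < c) (hγ : 0 ≤ γ) (hγβ : 0 < γ ∨ β = 0) {κ : ℝ}
    {u : Tuple N} (hEL : ∀ h, bil c σ τ γ u h = κ / 2 * dcubic β α u h) :
    ∃ (Φ₁ : Fin N → ℝ → ℝ) (Ψ₁ Ψ₂ : ℝ → ℝ),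
      IsClassical c σ τ β γ α (fun j => (κ • u.1 j).fn) Φ₁ (κ • u.2).fn Ψ₁ Ψ₂ ∧
      Tendsto (fun x => (κ • u.2).fn x ^ 2) (cocompact ℝ) (𝓝 0) := by
  have hcf : ∀ j, Continuous (u.1 j).fn := fun j => (u.1 j).continuous_fn
  have hcg : Continuous u.2.fn := u.2.continuous_fn
  have hτ' : c - τ ≠ 0 := (sub_pos.2 hτ).ne'
  choose f₁ hf hf₁ hfae using fun j => (u.1 j).exists_hasDerivAt_of_weak
    (r := fun x => σ * (u.1 j).fn x - κ * α j * ((u.1 j).fn x * u.2.fn x))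
    (by have := hcf j; fun_prop) (fun φ hφ hc => weak_short hEL j (ofContDiff hφ hc))
  have hshort : ∀ j x, HasDerivAt (κ • u.1 j).fn (κ * f₁ j x) x := fun j x =>
    (hf j x).const_mul κ
  have hshort' : ∀ j x, HasDerivAt (fun x => κ * f₁ j x)
      (σ * (κ • u.1 j).fn x - α j * (κ • u.1 j).fn x * (κ • u.2).fn x) x := fun j x => by
    refine ((hf₁ j x).const_mul κ).congr_deriv ?_
    simp only [fn_smul]
    ring
  have hlim : ∀ j, Tendsto (fun x => (κ • u.1 j).fn x ^ 2) (cocompact ℝ) (𝓝 0) := fun j =>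
    tendsto_fn_sq _ (hshort j) ((hfae j).mono fun x hx => by simp only [dv_smul, hx])
  obtain ⟨r, hrd⟩ : ∃ r : ℝ → ℝ, r = fun x => (c - τ) * u.2.fn x - κ / 2 *
      (β * (u.2.fn x * u.2.fn x) + ∑ j, α j * ((u.1 j).fn x * (u.1 j).fn x)) := ⟨_, rfl⟩
  have hrx : ∀ x, r x = (c - τ) * u.2.fn x - κ / 2 *
      (β * (u.2.fn x * u.2.fn x) + ∑ j, α j * ((u.1 j).fn x * (u.1 j).fn x)) := congrFun hrd
  have hrc : Continuous r := by rw [hrd]; fun_prop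
  have hr : ∀ η : H1, γ * ipd u.2 η = -∫ x, r x * η.fn x := fun η => by
    rw [hrd]; exact weak_long hEL η
  rcases hγ.lt_or_eq with hγ' | rfl
  · obtain ⟨g₁, hg, hg₁, hgae⟩ := u.2.exists_hasDerivAt_of_weak (r := fun x => r x / γ)
      (by fun_prop) (fun φ hφ hc => by
        have h := hr (ofContDiff hφ hc)
        simp only [div_mul_eq_mul_div, integral_div]
        rw [← neg_div, eq_div_iff hγ'.ne', mul_comm, h]
        rfl)
    refine ⟨fun j x => κ * f₁ j x, fun x => κ * g₁ x, fun x => κ * (r x / γ), ⟨hshort, hshort',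
      fun x => (hg x).const_mul κ, fun x => (hg₁ x).const_mul κ, fun x => ?_⟩,
      tendsto_fn_sq _ (fun x => (hg x).const_mul κ)
        (hgae.mono fun x hx => by simp only [dv_smul, hx])⟩
    have e : ∑ j, α j * (κ • u.1 j).fn x ^ 2 =
        κ ^ 2 * ∑ j, α j * ((u.1 j).fn x * (u.1 j).fn x) := by
      simp only [fn_smul, Finset.mul_sum]
      exact Finset.sum_congr rfl fun j _ => by ring
    rw [e, hrx, fn_smul]
    field_simp
    ring
  · obtain rfl : β = 0 := hγβ.resolve_left (lt_irrefl _)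
    -- With γ = 0 the weak equation says that r integrates to 0 against every test function; by
    -- continuity r vanishes everywhere.
    have hg : ∀ x, u.2.fn x = κ / (2 * (c - τ)) * ∑ j, α j * ((u.1 j).fn x * (u.1 j).fn x) := by
      have h0 := ae_eq_of_integral_contDiff_smul_eq hrc.locallyIntegrable (f' := fun _ => (0:ℝ))
        (μ := volume) (continuous_const.locallyIntegrable) (fun φ hφ hc => by
          have h := hr (ofContDiff hφ hc)
          rw [zero_mul, eq_comm, neg_eq_zero] at h
          simp only [smul_eq_mul, mul_comm (φ _), zero_mul, integral_zero]
          exact h)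
      have h1 := (Continuous.ae_eq_iff_eq (μ := volume) hrc continuous_const).1 h0
      intro x
      have h2 := congrFun h1 x
      simp only [hrx, zero_mul, zero_add] at h2
      rw [div_mul_eq_mul_div, eq_div_iff (mul_ne_zero two_ne_zero hτ')]
      linarith
    have hΨ : (κ • u.2).fn = fun x => 1 / (2 * (c - τ)) *
        ∑ j, α j * ((κ • u.1 j).fn x * (κ • u.1 j).fn x) := by
      funext x
      simp only [fn_smul, hg, Finset.mul_sum]
      exact Finset.sum_congr rfl fun j _ => by ring
    have hlong' := fun x => (HasDerivAt.fun_sum (u := Finset.univ) fun j _ =>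
      (((hshort' j x).mul (hshort j x)).add ((hshort j x).mul (hshort' j x))).const_mul
        (α j)).const_mul (1 / (2 * (c - τ)))
    refine ⟨fun j x => κ * f₁ j x, fun x => 1 / (2 * (c - τ)) *
        ∑ j, α j * (κ * f₁ j x * (κ • u.1 j).fn x + (κ • u.1 j).fn x * (κ * f₁ j x)), _,
      ⟨hshort, hshort', fun x => ?_, fun x => hlong' x, fun x => ?_⟩,
      ?_⟩
    · rw [hΨ]
      exact (HasDerivAt.fun_sum fun j _ =>
        ((hshort j x).mul (hshort j x)).const_mul (α j)).const_mul _
    · rw [hΨ]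
      simp only [pow_two]
      field_simp
      ring
    · rw [hΨ]
      have := (tendsto_finsetSum Finset.univ fun j _ =>
        (hlim j).const_mul (α j)).const_mul (1 / (2 * (c - τ))) |>.pow 2
      simpa [pow_two] using this

end LSI

end EulerLagrange

/-! ### Exponential decay and algebras closed under differentiation. -/

section ExponentialDecay
open Set Filter Topology

theorem integrable_exp_neg_mul_abs {a : ℝ} (ha : 0 < a) :
    Integrable fun x : ℝ => Real.exp (-a * |x|) := by
  rw [← integrableOn_univ, ← Iic_union_Ioi (a := (0 : ℝ)), integrableOn_union]
  constructor
  · refine (integrableOn_exp_mul_Iic ha 0).congr_fun (fun x hx => ?_) measurableSet_Iic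
    simp only [abs_of_nonpos (show x ≤ 0 from hx)]
    ring_nf
  · refine (integrableOn_exp_mul_Ioi (neg_lt_zero.2 ha) 0).congr_fun (fun x hx => ?_)
      measurableSet_Ioi
    simp only [abs_of_pos (show 0 < x from hx)]

namespace LSI.ExpDecay

variable {f g : ℝ → ℝ}

theorem mono (hg : ExpDecay g) (h : ∀ x, |f x| ≤ |g x|) : ExpDecay f := by
  obtain ⟨C, hC, δ, hδ, hb⟩ := hg
  exact ⟨C, hC, δ, hδ, fun x => (h x).trans (hb x)⟩

theorem zero : ExpDecay (0 : ℝ → ℝ) :=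
  ⟨1, one_pos, 1, one_pos, fun x => by simp [Real.exp_nonneg]⟩

theorem add (hf : ExpDecay f) (hg : ExpDecay g) : ExpDecay (f + g) := by
  obtain ⟨C, hC, δ, hδ, hb⟩ := hf
  obtain ⟨C', hC', δ', hδ', hb'⟩ := hg
  refine ⟨C + C', by positivity, min δ δ', lt_min hδ hδ', fun x => ?_⟩
  have h1 : Real.exp (-δ * |x|) ≤ Real.exp (-min δ δ' * |x|) := by
    gcongr; exact min_le_left _ _
  have h2 : Real.exp (-δ' * |x|) ≤ Real.exp (-min δ δ' * |x|) := by
    gcongr; exact min_le_right _ _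
  calc |(f + g) x| ≤ |f x| + |g x| := abs_add_le _ _
    _ ≤ C * Real.exp (-δ * |x|) + C' * Real.exp (-δ' * |x|) := add_le_add (hb x) (hb' x)
    _ ≤ _ := by rw [add_mul]; gcongr

theorem mul (hf : ExpDecay f) (hg : ExpDecay g) : ExpDecay (f * g) := by
  obtain ⟨C, hC, δ, hδ, hb⟩ := hf
  obtain ⟨C', hC', δ', hδ', hb'⟩ := hg
  refine ⟨C * C', by positivity, δ + δ', by positivity, fun x => ?_⟩
  rw [Pi.mul_apply, abs_mul]
  calc |f x| * |g x| ≤ (C * Real.exp (-δ * |x|)) * (C' * Real.exp (-δ' * |x|)) := by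
        gcongr
        · exact hb x
        · exact hb' x
    _ = C * C' * (Real.exp (-δ * |x|) * Real.exp (-δ' * |x|)) := by ring
    _ = _ := by rw [← Real.exp_add]; ring_nf

theorem const_smul (r : ℝ) (hf : ExpDecay f) : ExpDecay (r • f) := by
  obtain ⟨C, hC, δ, hδ, hb⟩ := hf
  refine ⟨(|r| + 1) * C, by positivity, δ, hδ, fun x => ?_⟩
  rw [Pi.smul_apply, smul_eq_mul, abs_mul, mul_assoc]
  gcongr
  · linarith
  · exact hb x

theorem of_sq (hf : ExpDecay fun x => f x ^ 2) : ExpDecay f := by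
  obtain ⟨C, hC, δ, hδ, hb⟩ := hf
  refine ⟨√C, by positivity, δ / 2, by positivity, fun x => ?_⟩
  refine abs_le_of_sq_le_sq (le_of_le_of_eq ((le_abs_self _).trans (hb x)) ?_) (by positivity)
  rw [mul_pow, Real.sq_sqrt hC.le, ← Real.exp_nat_mul]
  congr 2
  push_cast
  ring

theorem memLp (hf : ExpDecay f) (hc : Continuous f) : MemLp f 2 := by
  obtain ⟨C, hC, δ, hδ, hb⟩ := hf
  rw [memLp_two_iff_integrable_sq hc.aestronglyMeasurable]
  refine ((integrable_exp_neg_mul_abs (a := 2 * δ) (by positivity)).const_mul (C ^ 2)).mono'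
    (hc.pow 2).aestronglyMeasurable (Eventually.of_forall fun x => ?_)
  rw [Real.norm_eq_abs, abs_of_nonneg (sq_nonneg _), ← sq_abs]
  calc |f x| ^ 2 ≤ (C * Real.exp (-δ * |x|)) ^ 2 := by gcongr; exact hb x
    _ = _ := by
      rw [mul_pow, ← Real.exp_nat_mul]
      congr 2
      push_cast
      ring

/-- Interpolation by two mean value steps on [x, x+1]: f₁(ξ) = f(x+1) - f(x) for some ξ, and f₁(x)
differs from f₁(ξ) by at most a value of |f₂| on this interval. Moving the base point by at most 1
costs a constant factor. -/
theorem hasDerivAt {f₁ f₂ : ℝ → ℝ} (hf : ExpDecay f) (hf₂ : ExpDecay f₂)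
    (h : ∀ x, HasDerivAt f (f₁ x) x) (h' : ∀ x, HasDerivAt f₁ (f₂ x) x) : ExpDecay f₁ := by
  obtain ⟨C, hC, δ, hδ, hb⟩ := hf
  obtain ⟨C', hC', δ', hδ', hb'⟩ := hf₂
  have hexp : ∀ a, 0 < a → ∀ x y, y ∈ Icc x (x + 1) →
      Real.exp (-a * |y|) ≤ Real.exp a * Real.exp (-a * |x|) := fun a ha x y hy => by
    rw [← Real.exp_add]
    gcongr
    have h1 : |x| ≤ |y| + 1 := by
      have : |x| ≤ |y| + |x - y| := by simpa using abs_add_le y (x - y)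
      have h2 : |x - y| ≤ 1 := abs_le.2 ⟨by linarith [hy.2], by linarith [hy.1]⟩
      linarith
    nlinarith
  have hD : ExpDecay (fun x => (C * Real.exp δ + C) * Real.exp (-δ * |x|)) :=
    ⟨C * Real.exp δ + C, by positivity, δ, hδ, fun x => by rw [abs_of_nonneg (by positivity)]⟩
  have hD' : ExpDecay (fun x => (C' * Real.exp δ') * Real.exp (-δ' * |x|)) :=
    ⟨C' * Real.exp δ', by positivity, δ', hδ', fun x => by rw [abs_of_nonneg (by positivity)]⟩
  refine (hD.add hD').mono fun x => ?_
  simp only [Pi.add_apply]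
  refine le_trans ?_ (le_abs_self _)
  have hx : x < x + 1 := by linarith
  obtain ⟨ξ, hξ, e1⟩ := exists_hasDerivAt_eq_slope f f₁ hx
    (fun y _ => (h y).continuousAt.continuousWithinAt) (fun y _ => h y)
  obtain ⟨η, hη, e2⟩ := exists_hasDerivAt_eq_slope f₁ f₂ hξ.1
    (fun y _ => (h' y).continuousAt.continuousWithinAt) (fun y _ => h' y)
  rw [eq_div_iff (by linarith [hξ.1])] at e2
  rw [add_sub_cancel_left, div_one] at e1
  have b1 : |f (x + 1)| ≤ C * (Real.exp δ * Real.exp (-δ * |x|)) :=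
    (hb _).trans (mul_le_mul_of_nonneg_left (hexp δ hδ x (x + 1) ⟨by linarith, le_rfl⟩) hC.le)
  have b2 := hb x
  have b3 : |f₂ η| ≤ C' * (Real.exp δ' * Real.exp (-δ' * |x|)) :=
    (hb' _).trans (mul_le_mul_of_nonneg_left
      (hexp δ' hδ' x η ⟨hη.1.le, hη.2.le.trans hξ.2.le⟩) hC'.le)
  have b4 : |f₂ η * (ξ - x)| ≤ |f₂ η| := by
    rw [abs_mul]
    refine mul_le_of_le_one_right (abs_nonneg _) (abs_le.2 ⟨?_, ?_⟩) <;> linarith [hξ.1, hξ.2]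
  have e3 : f₁ x = f (x + 1) - f x - f₂ η * (ξ - x) := by rw [e2, ← e1]; ring
  rw [e3]
  have := abs_sub (f (x + 1) - f x) (f₂ η * (ξ - x))
  have := abs_sub (f (x + 1)) (f x)
  linarith

end LSI.ExpDecay

/-- A bounded function whose second derivative dominates a positive multiple of it on a half line
decays exponentially there. -/
theorem le_exp_of_second_deriv {w w₁ w₂ : ℝ → ℝ} {δ R C : ℝ} (hδ : 0 < δ)
    (h : ∀ x, HasDerivAt w (w₁ x) x) (h' : ∀ x, HasDerivAt w₁ (w₂ x) x) (hC : ∀ x, w x ≤ C)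
    (hw : ∀ x, R ≤ x → δ ^ 2 * w x ≤ w₂ x) {x : ℝ} (hx : R ≤ x) :
    w x ≤ w R * Real.exp (-δ * (x - R)) := by
  have hE : ∀ (a x : ℝ), HasDerivAt (fun x => Real.exp (a * x)) (Real.exp (a * x) * a) x :=
    fun a x => by simpa using ((hasDerivAt_id x).const_mul a).exp
  -- Factor D² - δ² as (D - δ)(D + δ): on the half line, (D + δ)w times exp(-δx) is nondecreasing.
  have hv : ∀ x, HasDerivAt (fun x => (w₁ x + δ * w x) * Real.exp (-δ * x))
      ((w₂ x - δ ^ 2 * w x) * Real.exp (-δ * x)) x := fun x => by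
    refine (((h' x).add ((h x).const_mul δ)).mul (hE (-δ) x)).congr_deriv ?_
    simp only [Pi.add_apply]
    ring
  have hmono : MonotoneOn (fun x => (w₁ x + δ * w x) * Real.exp (-δ * x)) (Ici R) := by
    refine monotoneOn_of_hasDerivWithinAt_nonneg (convex_Ici R)
      (fun x _ => (hv x).continuousAt.continuousWithinAt) (fun x _ => (hv x).hasDerivWithinAt) ?_
    intro x hx
    rw [interior_Ici] at hx
    exact mul_nonneg (by linarith [hw x (le_of_lt hx)]) (Real.exp_pos _).le
  -- If (D + δ)w were positive somewhere it would grow at least linearly from there; as w ≤ C, this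
  -- makes w' ≥ 1 eventually, contradicting the upper bound.
  have hneg : ∀ x, R ≤ x → w₁ x + δ * w x ≤ 0 := by
    intro x₀ hx₀
    by_contra! hm
    set m := w₁ x₀ + δ * w x₀ with hm_def
    have hgrow : ∀ y, x₀ ≤ y → m * (1 + δ * (y - x₀)) ≤ w₁ y + δ * w y := by
      intro y hy
      have h1 := hmono hx₀ (hx₀.trans hy : R ≤ y) hy
      simp only at h1
      rw [← hm_def] at h1
      have h2 : m * Real.exp (δ * (y - x₀)) ≤ w₁ y + δ * w y := by
        have h3 := mul_le_mul_of_nonneg_right h1 (Real.exp_pos (δ * y)).le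
        rw [mul_assoc, mul_assoc, ← Real.exp_add, ← Real.exp_add] at h3
        rwa [show -δ * x₀ + δ * y = δ * (y - x₀) by ring, show -δ * y + δ * y = 0 by ring,
          Real.exp_zero, mul_one] at h3
      refine le_trans ?_ h2
      gcongr
      linarith [Real.add_one_le_exp (δ * (y - x₀))]
    have hK : 0 < |δ * C| + 1 := by positivity
    set X := x₀ + (|δ * C| + 1) / (m * δ) with hX
    have hX0 : x₀ ≤ X := by rw [hX]; linarith [div_pos hK (mul_pos hm hδ)]
    have hw1 : ∀ y, X ≤ y → 1 ≤ w₁ y := by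
      intro y hy
      have h1 := hgrow y (hX0.trans hy)
      have h2 : |δ * C| + 1 ≤ m * δ * (y - x₀) := by
        rw [← div_le_iff₀' (mul_pos hm hδ)]
        linarith
      have h3 := mul_le_mul_of_nonneg_left (hC y) hδ.le
      have h4 := le_abs_self (δ * C)
      linarith
    have hlong : X < X + (|C - w X| + 1) := by linarith [abs_nonneg (C - w X)]
    obtain ⟨ξ, hξ, e⟩ := exists_hasDerivAt_eq_slope w w₁ hlong
      (fun y _ => (h y).continuousAt.continuousWithinAt) (fun y _ => h y)
    have h5 := hw1 ξ hξ.1.le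
    rw [e, add_sub_cancel_left, le_div_iff₀ (by positivity)] at h5
    have := hC (X + (|C - w X| + 1))
    have := le_abs_self (C - w X)
    linarith
  have hz : ∀ x, HasDerivAt (fun x => w x * Real.exp (δ * x))
      ((w₁ x + δ * w x) * Real.exp (δ * x)) x := fun x => by
    refine ((h x).mul (hE δ x)).congr_deriv ?_
    ring
  -- The sign of (D + δ)w says exactly that w exp(δx) is nonincreasing.
  have hanti : AntitoneOn (fun x => w x * Real.exp (δ * x)) (Ici R) := by
    refine antitoneOn_of_hasDerivWithinAt_nonpos (convex_Ici R)
      (fun x _ => (hz x).continuousAt.continuousWithinAt) (fun x _ => (hz x).hasDerivWithinAt) ?_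
    intro x hx
    rw [interior_Ici] at hx
    exact mul_nonpos_of_nonpos_of_nonneg (hneg x (le_of_lt hx)) (Real.exp_pos _).le
  have h1 := mul_le_mul_of_nonneg_right (hanti (self_mem_Ici : R ∈ Ici R) hx hx)
    (Real.exp_pos (-δ * x)).le
  simp only [mul_assoc, ← Real.exp_add] at h1
  rw [show δ * x + -δ * x = 0 by ring, Real.exp_zero, mul_one] at h1
  rwa [show -δ * (x - R) = δ * R + -δ * x by ring]

theorem LSI.expDecay_of_second_deriv {w w₁ w₂ : ℝ → ℝ} {δ R C : ℝ} (hδ : 0 < δ)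
    (h : ∀ x, HasDerivAt w (w₁ x) x) (h' : ∀ x, HasDerivAt w₁ (w₂ x) x) (h0 : ∀ x, 0 ≤ w x)
    (hC : ∀ x, w x ≤ C) (hw : ∀ x, R ≤ |x| → δ ^ 2 * w x ≤ w₂ x) : LSI.ExpDecay w := by
  have hC0 : 0 ≤ C := (h0 0).trans (hC 0)
  refine ⟨(C + 1) * Real.exp (δ * R), by positivity, δ, hδ, fun x => ?_⟩
  rw [abs_of_nonneg (h0 x), mul_assoc, ← Real.exp_add]
  have key : ∀ y, w y * Real.exp (-δ * (|x| - R)) ≤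
      (C + 1) * Real.exp (δ * R + -δ * |x|) := fun y => by
    rw [show -δ * (|x| - R) = δ * R + -δ * |x| by ring]
    gcongr
    linarith [hC y]
  rcases lt_or_ge |x| R with hxR | hxR
  · have h1 : (1 : ℝ) ≤ Real.exp (δ * R + -δ * |x|) := Real.one_le_exp (by nlinarith)
    nlinarith [hC x]
  rcases le_total 0 x with hx | hx
  · rw [abs_of_nonneg hx] at hxR key ⊢
    exact (le_exp_of_second_deriv hδ h h' hC
      (fun y hy => hw y (hy.trans (le_abs_self y))) hxR).trans (key R)
  · rw [abs_of_nonpos hx] at hxR key ⊢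
    -- The left half line is reduced to the right one by reflection, which preserves the second
    -- derivative inequality.
    have hr : ∀ y, HasDerivAt (fun y => w (-y)) (-w₁ (-y)) y := fun y =>
      ((h (-y)).scomp y (hasDerivAt_neg y)).congr_deriv (by simp)
    have hr' : ∀ y, HasDerivAt (fun y => -w₁ (-y)) (w₂ (-y)) y := fun y =>
      ((h' (-y)).scomp y (hasDerivAt_neg y)).neg.congr_deriv (by simp)
    have := le_exp_of_second_deriv hδ hr hr' (fun y => hC (-y))
      (fun y hy => hw (-y) (by rw [abs_neg]; exact hy.trans (le_abs_self y))) hxR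
    rw [neg_neg] at this
    exact this.trans (key (-R))

section DerivClosed

/-- By the Leibniz rule closure under differentiation need only be checked on generators. The
algebra is non-unital because nonzero constants do not decay. -/
theorem exists_hasDerivAt_mem_adjoin {S : Set (ℝ → ℝ)}
    (hS : ∀ f ∈ S, ∃ f' ∈ NonUnitalAlgebra.adjoin ℝ S, ∀ x, HasDerivAt f (f' x) x) :
    ∀ f ∈ NonUnitalAlgebra.adjoin ℝ S,
      ∃ f' ∈ NonUnitalAlgebra.adjoin ℝ S, ∀ x, HasDerivAt f (f' x) x := by
  intro f hf
  induction hf using NonUnitalAlgebra.adjoin_induction with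
  | mem f hf => exact hS f hf
  | zero => exact ⟨0, zero_mem _, fun x => hasDerivAt_const x 0⟩
  | add f g hf hg ihf ihg =>
    obtain ⟨f', hf', h1⟩ := ihf
    obtain ⟨g', hg', h2⟩ := ihg
    exact ⟨f' + g', add_mem hf' hg', fun x => (h1 x).add (h2 x)⟩
  | mul f g hf hg ihf ihg =>
    obtain ⟨f', hf', h1⟩ := ihf
    obtain ⟨g', hg', h2⟩ := ihg
    exact ⟨f' * g + f * g', add_mem (mul_mem hf' hg) (mul_mem hf hg'), fun x => (h1 x).mul (h2 x)⟩
  | smul r f hf ihf =>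
    obtain ⟨f', hf', h1⟩ := ihf
    exact ⟨r • f', SMulMemClass.smul_mem r hf', fun x => (h1 x).const_smul r⟩

theorem LSI.expDecay_of_mem_adjoin {S : Set (ℝ → ℝ)} (hS : ∀ f ∈ S, LSI.ExpDecay f) :
    ∀ f ∈ NonUnitalAlgebra.adjoin ℝ S, LSI.ExpDecay f := by
  intro f hf
  induction hf using NonUnitalAlgebra.adjoin_induction with
  | mem f hf => exact hS f hf
  | zero => exact LSI.ExpDecay.zero
  | add f g _ _ ihf ihg => exact ihf.add ihg
  | mul f g _ _ ihf ihg => exact ihf.mul ihg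
  | smul r f _ ihf => exact ihf.const_smul r

theorem contDiff_of_forall_hasDerivAt_mem {A : Set (ℝ → ℝ)}
    (hA : ∀ f ∈ A, ∃ f' ∈ A, ∀ x, HasDerivAt f (f' x) x) {f : ℝ → ℝ} (hf : f ∈ A) :
    ContDiff ℝ ∞ f := by
  rw [contDiff_infty]
  intro n
  induction n generalizing f with
  | zero =>
    obtain ⟨f', -, h⟩ := hA f hf
    exact contDiff_zero.2 (continuous_iff_continuousAt.2 fun x => (h x).continuousAt)
  | succ n ih =>
    obtain ⟨f', hf', h⟩ := hA f hf
    have hd : deriv f = f' := funext fun x => (h x).deriv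
    rw [Nat.cast_succ, contDiff_succ_iff_deriv, hd]
    exact ⟨fun x => (h x).differentiableAt, by simp, ih hf'⟩

theorem memHInfty_of_forall_hasDerivAt_mem {A : Set (ℝ → ℝ)}
    (hA : ∀ f ∈ A, ∃ f' ∈ A, ∀ x, HasDerivAt f (f' x) x) (hE : ∀ f ∈ A, LSI.ExpDecay f)
    {f : ℝ → ℝ} (hf : f ∈ A) : MemHInfty f := by
  intro k
  induction k generalizing f with
  | zero => exact (hE f hf).memLp (contDiff_of_forall_hasDerivAt_mem hA hf).continuous
  | succ k ih =>
    have hs := contDiff_of_forall_hasDerivAt_mem hA hf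
    obtain ⟨f', hf', h⟩ := hA f hf
    have hd : deriv f = f' := funext fun x => (h x).deriv
    exact ⟨(hE f hf).memLp hs.continuous, f',
      hd ▸ (isPrimitive_deriv (hs.of_le (by exact_mod_cast le_top))).isWeakDeriv, ih hf'⟩

end DerivClosed

end ExponentialDecay

/-! ### Decay and regularity of the profiles, and the travelling waves. -/

section SolitaryWaves
open Set Filter Topology

theorem exists_forall_le_abs_of_eventually_cocompact {p : ℝ → Prop}
    (h : ∀ᶠ x in cocompact ℝ, p x) : ∃ R, ∀ x, R ≤ |x| → p x := by
  rw [← Metric.cobounded_eq_cocompact, ← comap_norm_atTop, eventually_comap] at h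
  obtain ⟨R, hR⟩ := eventually_atTop.1 h
  exact ⟨R, fun x hx => hR |x| hx x rfl⟩

theorem exists_abs_le_of_tendsto_sq {f : ℝ → ℝ}
    (h : Tendsto (fun x => f x ^ 2) (cocompact ℝ) (𝓝 0)) {ε : ℝ} (hε : 0 < ε) :
    ∃ R, ∀ x, R ≤ |x| → |f x| ≤ ε :=
  exists_forall_le_abs_of_eventually_cocompact <|
    (h.eventually_lt_const (by positivity : (0 : ℝ) < ε ^ 2)).mono fun _ hx =>
      abs_le_of_sq_le_sq hx.le hε.le

namespace LSI.IsClassical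

variable {N : ℕ} {c σ τ β γ : ℝ} {α : Fin N → ℝ} {Φ Φ₁ : Fin N → ℝ → ℝ} {Ψ Ψ₁ Ψ₂ : ℝ → ℝ}

/-- (Φⱼ²)'' = 2Φⱼ'² + 2(σ - αⱼΨ)Φⱼ² ≥ σΦⱼ² as soon as αⱼΨ ≤ σ/2, which holds far out because Ψ tends
to 0. -/
theorem expDecay_short_sq (h : IsClassical c σ τ β γ α Φ Φ₁ Ψ Ψ₁ Ψ₂) (hσ : 0 < σ)
    (hα : ∀ j, 0 < α j) (hΨ : Tendsto (fun x => Ψ x ^ 2) (cocompact ℝ) (𝓝 0)) {j : Fin N}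
    (hb : ∃ C, ∀ x, |Φ j x| ≤ C) : ExpDecay fun x => Φ j x ^ 2 := by
  have hαj := hα j
  obtain ⟨R, hR⟩ := exists_abs_le_of_tendsto_sq hΨ (by positivity : 0 < σ / (2 * α j))
  obtain ⟨C, hC⟩ := hb
  refine expDecay_of_second_deriv (w₁ := fun x => Φ₁ j x * Φ j x + Φ j x * Φ₁ j x)
    (w₂ := fun x => ((σ * Φ j x - α j * Φ j x * Ψ x) * Φ j x + Φ₁ j x * Φ₁ j x) +
      (Φ₁ j x * Φ₁ j x + Φ j x * (σ * Φ j x - α j * Φ j x * Ψ x))) (R := R) (C := C ^ 2)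
    (Real.sqrt_pos.2 hσ) (fun x => ?_)
    (fun x => ((h.short' j x).mul (h.short j x)).add ((h.short j x).mul (h.short' j x)))
    (fun x => sq_nonneg _) (fun x => sq_le_sq' (abs_le.1 (hC x)).1 (abs_le.1 (hC x)).2)
    (fun x hx => ?_)
  · simp only [pow_two]
    exact (h.short j x).mul (h.short j x)
  · rw [Real.sq_sqrt hσ.le]
    have h1 : Ψ x ≤ σ / (2 * α j) := (le_abs_self _).trans (hR x hx)
    rw [le_div_iff₀ (by positivity)] at h1
    nlinarith [mul_self_nonneg (Φ₁ j x), mul_le_mul_of_nonneg_right h1 (sq_nonneg (Φ j x))]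

/-- The equation for Ψ is forced by ∑ αⱼΦⱼ², so Ψ² alone need not satisfy a homogeneous inequality;
the sum of all squares does. -/
theorem expDecay_sum_sq (h : IsClassical c σ τ β γ α Φ Φ₁ Ψ Ψ₁ Ψ₂) (hσ : 0 < σ) (hτ : τ < c)
    (hβ : 0 ≤ β) (hγ : 0 < γ) (hα : ∀ j, 0 < α j)
    (hΨ : Tendsto (fun x => Ψ x ^ 2) (cocompact ℝ) (𝓝 0)) (hb : ∀ j, ∃ C, ∀ x, |Φ j x| ≤ C)
    (hb' : ∃ C, ∀ x, |Ψ x| ≤ C) : ExpDecay fun x => ∑ j, Φ j x ^ 2 + Ψ x ^ 2 := by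
  have hτ' : 0 < c - τ := sub_pos.2 hτ
  obtain ⟨a, ha⟩ : ∃ a, a = ∑ j, α j := ⟨_, rfl⟩
  have ha0 : 0 ≤ a := ha ▸ Finset.sum_nonneg fun j _ => (hα j).le
  have hαa : ∀ j, α j ≤ a := fun j => ha ▸ Finset.single_le_sum (fun i _ => (hα i).le)
    (Finset.mem_univ j)
  -- For |Ψ| ≤ ε the first condition absorbs the coupling terms of the short equations (2aε) and of
  -- the long equation (aε/γ) into σ, the second absorbs the cubic term βΨ³ into c - τ.
  obtain ⟨ε, hε0, hε1, hε2⟩ : ∃ ε, 0 < ε ∧ (2 * a + a / γ) * ε ≤ σ ∧ β * ε ≤ c - τ := by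
    refine ⟨min (σ / (2 * a + a / γ + 1)) ((c - τ) / (β + 1)), by positivity, ?_, ?_⟩
    · have h1 := min_le_left (σ / (2 * a + a / γ + 1)) ((c - τ) / (β + 1))
      rw [le_div_iff₀ (by positivity)] at h1
      have : 0 < min (σ / (2 * a + a / γ + 1)) ((c - τ) / (β + 1)) := by positivity
      linarith
    · have h1 := min_le_right (σ / (2 * a + a / γ + 1)) ((c - τ) / (β + 1))
      rw [le_div_iff₀ (by positivity)] at h1
      have : 0 < min (σ / (2 * a + a / γ + 1)) ((c - τ) / (β + 1)) := by positivity
      linarith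
  obtain ⟨R, hR⟩ := exists_abs_le_of_tendsto_sq hΨ hε0
  choose C hC using hb
  obtain ⟨C', hC'⟩ := hb'
  have hm : 0 < min σ ((c - τ) / γ) := by positivity
  refine expDecay_of_second_deriv
    (w₁ := fun x => ∑ j, (Φ₁ j x * Φ j x + Φ j x * Φ₁ j x) + (Ψ₁ x * Ψ x + Ψ x * Ψ₁ x))
    (w₂ := fun x => ∑ j, (((σ * Φ j x - α j * Φ j x * Ψ x) * Φ j x + Φ₁ j x * Φ₁ j x) +
      (Φ₁ j x * Φ₁ j x + Φ j x * (σ * Φ j x - α j * Φ j x * Ψ x))) +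
      ((Ψ₂ x * Ψ x + Ψ₁ x * Ψ₁ x) + (Ψ₁ x * Ψ₁ x + Ψ x * Ψ₂ x)))
    (R := R) (C := ∑ j, C j ^ 2 + C' ^ 2) (Real.sqrt_pos.2 hm) (fun x => ?_) (fun x => ?_)
    (fun x => by positivity) (fun x => ?_) (fun x hx => ?_)
  · simp only [pow_two]
    exact (HasDerivAt.fun_sum fun j _ => (h.short j x).mul (h.short j x)).add
      ((h.long x).mul (h.long x))
  · exact (HasDerivAt.fun_sum fun j _ => ((h.short' j x).mul (h.short j x)).add
      ((h.short j x).mul (h.short' j x))).add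
      (((h.long' x).mul (h.long x)).add ((h.long x).mul (h.long' x)))
  · exact add_le_add (Finset.sum_le_sum fun j _ =>
      sq_le_sq' (abs_le.1 (hC j x)).1 (abs_le.1 (hC j x)).2)
      (sq_le_sq' (abs_le.1 (hC' x)).1 (abs_le.1 (hC' x)).2)
  · rw [Real.sq_sqrt hm.le]
    obtain ⟨hΨ1, hΨ2⟩ := abs_le.1 (hR x hx)
    obtain ⟨S, hS⟩ : ∃ S, S = ∑ j, Φ j x ^ 2 := ⟨_, rfl⟩
    obtain ⟨Q, hQ⟩ : ∃ Q, Q = ∑ j, α j * Φ j x ^ 2 := ⟨_, rfl⟩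
    have hS0 : 0 ≤ S := hS ▸ Finset.sum_nonneg fun j _ => sq_nonneg _
    have hQ0 : 0 ≤ Q := hQ ▸ Finset.sum_nonneg fun j _ => mul_nonneg (hα j).le (sq_nonneg _)
    have hQS : Q ≤ a * S := by
      rw [hQ, hS, Finset.mul_sum]
      exact Finset.sum_le_sum fun j _ => mul_le_mul_of_nonneg_right (hαa j) (sq_nonneg _)
    have h1 : 2 * σ * S - 2 * Ψ x * Q ≤
        ∑ j, (((σ * Φ j x - α j * Φ j x * Ψ x) * Φ j x + Φ₁ j x * Φ₁ j x) +
        (Φ₁ j x * Φ₁ j x + Φ j x * (σ * Φ j x - α j * Φ j x * Ψ x))) := by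
      rw [hS, hQ, Finset.mul_sum, Finset.mul_sum, ← Finset.sum_sub_distrib]
      refine Finset.sum_le_sum fun j _ => ?_
      nlinarith [mul_self_nonneg (Φ₁ j x)]
    have h2 : Ψ₂ x = ((c - τ) * Ψ x - 1 / 2 * β * Ψ x ^ 2 - 1 / 2 * Q) / γ := by
      rw [eq_div_iff hγ.ne', mul_comm, h.eq x, hQ]
    have h3 : Ψ x * Q ≤ ε * (a * S) :=
      (mul_le_mul_of_nonneg_right hΨ2 hQ0).trans (mul_le_mul_of_nonneg_left hQS hε0.le)
    have h4 : Ψ x ^ 3 ≤ ε * Ψ x ^ 2 := by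
      rw [pow_succ' _ 2]
      exact mul_le_mul_of_nonneg_right hΨ2 (sq_nonneg _)
    have h5 : ((c - τ) * Ψ x ^ 2 - a * ε * S) / γ ≤ 2 * (Ψ x * Ψ₂ x) := by
      rw [h2, div_le_iff₀ hγ, mul_assoc 2, mul_assoc (Ψ x), div_mul_cancel₀ _ hγ.ne']
      nlinarith [mul_le_mul_of_nonneg_left h4 hβ, mul_le_mul_of_nonneg_right hε2 (sq_nonneg (Ψ x))]
    have h6 : σ * S + (c - τ) / γ * Ψ x ^ 2 ≤ 2 * σ * S - 2 * Ψ x * Q +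
        ((c - τ) * Ψ x ^ 2 - a * ε * S) / γ := by
      have e : ((c - τ) * Ψ x ^ 2 - a * ε * S) / γ = (c - τ) / γ * Ψ x ^ 2 - a / γ * ε * S := by
        field_simp
      rw [e]
      have := mul_le_mul_of_nonneg_right hε1 hS0
      linarith
    have h7 : min σ ((c - τ) / γ) * (S + Ψ x ^ 2) ≤ σ * S + (c - τ) / γ * Ψ x ^ 2 := by
      rw [mul_add]
      exact add_le_add (mul_le_mul_of_nonneg_right (min_le_left _ _) hS0)
        (mul_le_mul_of_nonneg_right (min_le_right _ _) (sq_nonneg _))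
    rw [← hS]
    linarith [mul_self_nonneg (Ψ₁ x)]

theorem long_eq_of_zero (h : IsClassical c σ τ 0 0 α Φ Φ₁ Ψ Ψ₁ Ψ₂) (hτ : τ < c) :
    Ψ = (1 / (2 * (c - τ))) • ∑ j, α j • (Φ j * Φ j) := by
  have hτ' : c - τ ≠ 0 := (sub_pos.2 hτ).ne'
  funext x
  have := h.eq x
  simp only [Pi.smul_apply, Finset.sum_apply, Pi.mul_apply, smul_eq_mul]
  simp only [← pow_two]
  rw [one_div_mul_eq_div, eq_div_iff (mul_ne_zero two_ne_zero hτ')]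
  linarith

theorem expDecay (h : IsClassical c σ τ β γ α Φ Φ₁ Ψ Ψ₁ Ψ₂) (hσ : 0 < σ) (hτ : τ < c)
    (hβ : 0 ≤ β) (hγ : 0 ≤ γ) (hγβ : 0 < γ ∨ β = 0) (hα : ∀ j, 0 < α j)
    (hΨ : Tendsto (fun x => Ψ x ^ 2) (cocompact ℝ) (𝓝 0)) (hb : ∀ j, ∃ C, ∀ x, |Φ j x| ≤ C)
    (hb' : ∃ C, ∀ x, |Ψ x| ≤ C) : (∀ j, ExpDecay (Φ j)) ∧ ExpDecay Ψ := by
  have hshort : ∀ j, ExpDecay (Φ j) := fun j => (h.expDecay_short_sq hσ hα hΨ (hb j)).of_sq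
  refine ⟨hshort, ?_⟩
  rcases hγ.lt_or_eq with hγ' | rfl
  · refine ((h.expDecay_sum_sq hσ hτ hβ hγ' hα hΨ hb hb').mono fun x => ?_).of_sq
    have : 0 ≤ ∑ j, Φ j x ^ 2 := Finset.sum_nonneg fun j _ => sq_nonneg _
    rw [abs_of_nonneg (by positivity), abs_of_nonneg (by positivity)]
    linarith
  · obtain rfl : β = 0 := hγβ.resolve_left (lt_irrefl _)
    rw [h.long_eq_of_zero hτ]
    refine expDecay_of_mem_adjoin (S := range Φ) (by rintro _ ⟨j, rfl⟩; exact hshort j) _ ?_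
    have hm : ∀ j, Φ j ∈ NonUnitalAlgebra.adjoin ℝ (range Φ) := fun j =>
      NonUnitalAlgebra.subset_adjoin ℝ ⟨j, rfl⟩
    exact SMulMemClass.smul_mem _ (sum_mem fun j _ =>
      SMulMemClass.smul_mem _ (mul_mem (hm j) (hm j)))

/-- For γ > 0 the equation can be solved for Ψ₂. For γ = 0 it says nothing about Ψ₂, which is
instead found by differentiating the algebraic formula for Ψ twice. -/
theorem long_second_mem (h : IsClassical c σ τ β γ α Φ Φ₁ Ψ Ψ₁ Ψ₂) (hτ : τ < c)
    (hγ : 0 ≤ γ) (hγβ : 0 < γ ∨ β = 0) {A : NonUnitalSubalgebra ℝ (ℝ → ℝ)}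
    (hΦ : ∀ j, Φ j ∈ A) (hΦ₁ : ∀ j, Φ₁ j ∈ A)
    (hΦ₂ : ∀ j, (fun x => σ * Φ j x - α j * Φ j x * Ψ x) ∈ A) (hΨ : Ψ ∈ A) : Ψ₂ ∈ A := by
  rcases hγ.lt_or_eq with hγ' | rfl
  · have e : Ψ₂ = (1 / γ) • ((c - τ) • Ψ - (1 / 2 * β) • (Ψ * Ψ) -
        (1 / 2 : ℝ) • ∑ j, α j • (Φ j * Φ j)) := by
      funext x
      simp only [Pi.smul_apply, Pi.sub_apply, Finset.sum_apply, Pi.mul_apply, smul_eq_mul]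
      simp only [← pow_two]
      rw [one_div_mul_eq_div, eq_div_iff hγ'.ne', mul_comm, h.eq x]
    rw [e]
    exact SMulMemClass.smul_mem _ (sub_mem (sub_mem (SMulMemClass.smul_mem _ hΨ)
      (SMulMemClass.smul_mem _ (mul_mem hΨ hΨ))) (SMulMemClass.smul_mem _ (sum_mem fun j _ =>
      SMulMemClass.smul_mem _ (mul_mem (hΦ j) (hΦ j)))))
  · obtain rfl : β = 0 := hγβ.resolve_left (lt_irrefl _)
    have e := h.long_eq_of_zero hτ
    have e₁ : Ψ₁ = (1 / (2 * (c - τ))) • ∑ j, α j • (Φ₁ j * Φ j + Φ j * Φ₁ j) := by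
      funext x
      refine (h.long x).unique ?_
      rw [e]
      exact ((HasDerivAt.sum fun j _ => (((h.short j x).mul (h.short j x)).const_smul
        (α j))).const_smul _).congr_deriv (by
          simp only [Pi.smul_apply, Finset.sum_apply, Pi.add_apply, Pi.mul_apply])
    have e₂ : Ψ₂ = (1 / (2 * (c - τ))) • ∑ j, α j •
        (((fun x => σ * Φ j x - α j * Φ j x * Ψ x) * Φ j + Φ₁ j * Φ₁ j) +
        (Φ₁ j * Φ₁ j + Φ j * fun x => σ * Φ j x - α j * Φ j x * Ψ x)) := by
      funext x
      refine (h.long' x).unique ?_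
      rw [e₁]
      exact ((HasDerivAt.sum fun j _ => ((((h.short' j x).mul (h.short j x)).add
        ((h.short j x).mul (h.short' j x))).const_smul (α j))).const_smul _).congr_deriv (by
          simp only [Pi.smul_apply, Finset.sum_apply, Pi.add_apply, Pi.mul_apply])
    rw [e₂]
    exact SMulMemClass.smul_mem _ (sum_mem fun j _ => SMulMemClass.smul_mem _
      (add_mem (add_mem (mul_mem (hΦ₂ j) (hΦ j)) (mul_mem (hΦ₁ j) (hΦ₁ j)))
      (add_mem (mul_mem (hΦ₁ j) (hΦ₁ j)) (mul_mem (hΦ j) (hΦ₂ j)))))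

theorem regularity (h : IsClassical c σ τ β γ α Φ Φ₁ Ψ Ψ₁ Ψ₂) (hτ : τ < c)
    (hγ : 0 ≤ γ) (hγβ : 0 < γ ∨ β = 0) (hΦ : ∀ j, ExpDecay (Φ j)) (hΨ : ExpDecay Ψ) :
    (∀ j, ContDiff ℝ ∞ (Φ j)) ∧ ContDiff ℝ ∞ Ψ ∧ (∀ j, MemHInfty (Φ j)) ∧ MemHInfty Ψ := by
  have key : ∀ A : NonUnitalSubalgebra ℝ (ℝ → ℝ), (∀ j, Φ j ∈ A) → Ψ ∈ A →
      ∀ j, (fun x => σ * Φ j x - α j * Φ j x * Ψ x) ∈ A := fun A h1 h2 j => by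
    have e : (fun x => σ * Φ j x - α j * Φ j x * Ψ x) = σ • Φ j - α j • (Φ j * Ψ) := by
      funext x
      simp only [Pi.sub_apply, Pi.smul_apply, Pi.mul_apply, smul_eq_mul, mul_assoc]
    rw [e]
    exact sub_mem (SMulMemClass.smul_mem _ (h1 j))
      (SMulMemClass.smul_mem _ (mul_mem (h1 j) h2))
  -- Decay spreads in stages: the Φⱼ'' lie in the algebra of S₀, so the Φⱼ' decay; Ψ'' lies in that
  -- of S₁, where the Φⱼ' are needed if γ = 0, so Ψ' decays. The algebra of S is then closed under
  -- differentiation.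
  let S₀ : Set (ℝ → ℝ) := range Φ ∪ {Ψ}
  let S₁ : Set (ℝ → ℝ) := range Φ ∪ range Φ₁ ∪ {Ψ}
  let S : Set (ℝ → ℝ) := range Φ ∪ range Φ₁ ∪ {Ψ} ∪ {Ψ₁}
  have hS₀ : ∀ f ∈ S₀, ExpDecay f := by
    rintro _ (⟨j, rfl⟩ | rfl)
    exacts [hΦ j, hΨ]
  have hΦ₁ : ∀ j, ExpDecay (Φ₁ j) := fun j => (hΦ j).hasDerivAt
    (expDecay_of_mem_adjoin hS₀ _ (key _
      (fun i => NonUnitalAlgebra.subset_adjoin ℝ (Or.inl ⟨i, rfl⟩))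
      (NonUnitalAlgebra.subset_adjoin ℝ (Or.inr rfl)) j)) (h.short j) (h.short' j)
  have hS₁ : ∀ f ∈ S₁, ExpDecay f := by
    rintro _ ((⟨j, rfl⟩ | ⟨j, rfl⟩) | rfl)
    exacts [hΦ j, hΦ₁ j, hΨ]
  have m1 : ∀ j, Φ j ∈ NonUnitalAlgebra.adjoin ℝ S₁ := fun j =>
    NonUnitalAlgebra.subset_adjoin ℝ (Or.inl (Or.inl ⟨j, rfl⟩))
  have m2 : ∀ j, Φ₁ j ∈ NonUnitalAlgebra.adjoin ℝ S₁ := fun j =>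
    NonUnitalAlgebra.subset_adjoin ℝ (Or.inl (Or.inr ⟨j, rfl⟩))
  have m3 : Ψ ∈ NonUnitalAlgebra.adjoin ℝ S₁ := NonUnitalAlgebra.subset_adjoin ℝ (Or.inr rfl)
  have m4 := key _ m1 m3
  have m5 := h.long_second_mem hτ hγ hγβ m1 m2 m4 m3
  have hΨ₁ : ExpDecay Ψ₁ := hΨ.hasDerivAt (expDecay_of_mem_adjoin hS₁ _ m5) h.long h.long'
  have hS : ∀ f ∈ S, ExpDecay f := by
    rintro _ (((⟨j, rfl⟩ | ⟨j, rfl⟩) | rfl) | rfl)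
    exacts [hΦ j, hΦ₁ j, hΨ, hΨ₁]
  have hsub : NonUnitalAlgebra.adjoin ℝ S₁ ≤ NonUnitalAlgebra.adjoin ℝ S :=
    NonUnitalAlgebra.adjoin_mono subset_union_left
  have hd := exists_hasDerivAt_mem_adjoin (S := S) (by
    rintro _ (((⟨j, rfl⟩ | ⟨j, rfl⟩) | rfl) | rfl)
    · exact ⟨_, hsub (m2 j), h.short j⟩
    · exact ⟨_, hsub (m4 j), h.short' j⟩
    · exact ⟨_, NonUnitalAlgebra.subset_adjoin ℝ (Or.inr rfl), h.long⟩
    · exact ⟨_, hsub m5, h.long'⟩)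
  have hE := expDecay_of_mem_adjoin hS
  exact ⟨fun j => contDiff_of_forall_hasDerivAt_mem hd (hsub (m1 j)),
    contDiff_of_forall_hasDerivAt_mem hd (hsub m3),
    fun j => memHInfty_of_forall_hasDerivAt_mem hd hE (hsub (m1 j)),
    memHInfty_of_forall_hasDerivAt_mem hd hE (hsub m3)⟩

theorem solvesODE (h : IsClassical c σ τ β γ α Φ Φ₁ Ψ Ψ₁ Ψ₂) (hΦ : ∀ j, ContDiff ℝ ∞ (Φ j))
    (hΨ : ContDiff ℝ ∞ Ψ) : SolvesODE c σ τ β γ α Φ Ψ where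
  smooth_short := hΦ
  smooth_long := hΨ
  short_eq j x := by
    have e : deriv (Φ j) = Φ₁ j := funext fun x => (h.short j x).deriv
    rw [iteratedDeriv_succ, iteratedDeriv_one, e, (h.short' j x).deriv]
    ring
  long_eq x := by
    have e : deriv Ψ = Ψ₁ := funext fun x => (h.long x).deriv
    rw [iteratedDeriv_succ, iteratedDeriv_one, e, (h.long' x).deriv, h.eq x]
    ring

end LSI.IsClassical

namespace LSI

variable {N : ℕ} {c σ τ β γ lam : ℝ} {α : Fin N → ℝ}

theorem contDiff_shortWave (c om : ℝ) {Φ : ℝ → ℝ} (hΦ : ContDiff ℝ ∞ Φ) :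
    ContDiff ℝ ∞ fun q : ℝ × ℝ => shortWave c om Φ q.1 q.2 := by
  have h : ContDiff ℝ ∞ fun q : ℝ × ℝ => q.1 - c * q.2 := by fun_prop
  have ho : ContDiff ℝ ∞ fun r : ℝ => (r : ℂ) := Complex.ofRealCLM.contDiff
  have h1 : ContDiff ℝ ∞ fun q : ℝ × ℝ => ((q.1 : ℝ) : ℂ) := ho.comp contDiff_fst
  have h2 : ContDiff ℝ ∞ fun q : ℝ × ℝ => ((q.2 : ℝ) : ℂ) := ho.comp contDiff_snd
  have h3 : ContDiff ℝ ∞ fun q : ℝ × ℝ => ((Φ (q.1 - c * q.2) : ℝ) : ℂ) := ho.comp (hΦ.comp h)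
  unfold shortWave
  refine ((ContDiff.cexp ?_).mul (ContDiff.cexp ?_)).mul h3
  · exact contDiff_const.mul h2
  · exact (contDiff_const.mul (h1.sub (contDiff_const.mul h2))).div_const 2

theorem hasDerivAt_shortWave_left (c om : ℝ) {f f' : ℝ → ℝ} (hf : ∀ x, HasDerivAt f (f' x) x)
    (x t : ℝ) : HasDerivAt (fun y => shortWave c om f y t)
      (Complex.I * c / 2 * shortWave c om f x t + shortWave c om f' x t) x := by
  have h1 : HasDerivAt (fun y : ℝ => Complex.I * c * ((y : ℂ) - c * t) / 2)
      (Complex.I * c / 2) x := by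
    refine ((((hasDerivAt_id x).ofReal_comp.sub_const ((c : ℂ) * t)).const_mul
      (Complex.I * c)).div_const 2).congr_deriv ?_
    simp
  have h2 : HasDerivAt (fun y : ℝ => ((f (y - c * t) : ℝ) : ℂ)) (f' (x - c * t) : ℝ) x :=
    ((hf (x - c * t)).comp_sub_const x (c * t)).ofReal_comp
  refine ((h1.cexp.const_mul (Complex.exp (Complex.I * om * t))).mul h2).congr_deriv ?_
  simp only [shortWave]
  ring

theorem hasDerivAt_shortWave_right (c om : ℝ) {f f' : ℝ → ℝ} (hf : ∀ x, HasDerivAt f (f' x) x)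
    (x t : ℝ) : HasDerivAt (fun s => shortWave c om f x s)
      ((Complex.I * om - Complex.I * c ^ 2 / 2) * shortWave c om f x t -
        c * shortWave c om f' x t) t := by
  have h0 : HasDerivAt (fun s : ℝ => Complex.I * om * (s : ℂ)) (Complex.I * om) t := by
    refine ((hasDerivAt_id t).ofReal_comp.const_mul (Complex.I * om)).congr_deriv ?_
    simp
  have h1 : HasDerivAt (fun s : ℝ => Complex.I * c * ((x : ℂ) - c * s) / 2)
      (-(Complex.I * c ^ 2 / 2)) t := by
    refine (((((hasDerivAt_id t).ofReal_comp.const_mul (c : ℂ)).const_sub (x : ℂ)).const_mul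
      (Complex.I * c)).div_const 2).congr_deriv ?_
    simp
    ring
  have h3 : HasDerivAt (fun s : ℝ => x - c * s) (-c) t := by
    refine (((hasDerivAt_id t).const_mul c).const_sub x).congr_deriv ?_
    simp
  have h2 : HasDerivAt (fun s : ℝ => ((f (x - c * s) : ℝ) : ℂ)) ((f' (x - c * t) * -c : ℝ) : ℂ) t :=
    ((hf (x - c * t)).comp t h3).ofReal_comp
  refine ((h0.cexp.mul h1.cexp).mul h2).congr_deriv ?_
  simp only [shortWave, Pi.mul_apply]
  push_cast
  ring

theorem norm_shortWave (c om : ℝ) (f : ℝ → ℝ) (x t : ℝ) :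
    ‖shortWave c om f x t‖ = |f (x - c * t)| := by
  have h1 : Complex.I * om * t = ((om * t : ℝ) : ℂ) * Complex.I := by push_cast; ring
  have h2 : Complex.I * c * (x - c * t) / 2 = ((c * (x - c * t) / 2 : ℝ) : ℂ) * Complex.I := by
    push_cast; ring
  rw [shortWave, norm_mul, norm_mul, h1, h2, Complex.norm_exp_ofReal_mul_I,
    Complex.norm_exp_ofReal_mul_I, Complex.norm_real, Real.norm_eq_abs, one_mul, one_mul]

/-- The carrier phase cancels the terms in Φⱼ', and ω = σ + c²/4 leaves -σ as the coefficient of uⱼ.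
As |uⱼ| = |Φⱼ|, the long-wave equation is the x-derivative of the profile equation for Ψ. -/
theorem IsClassical.solvesLSI {Φ Φ₁ : Fin N → ℝ → ℝ} {Ψ Ψ₁ Ψ₂ : ℝ → ℝ}
    (h : IsClassical c σ τ β γ α Φ Φ₁ Ψ Ψ₁ Ψ₂) (hΦ : ∀ j, ContDiff ℝ ∞ (Φ j))
    (hΨ : ContDiff ℝ ∞ Ψ) :
    SolvesLSI γ α (fun j => α j / 2)
      (Polynomial.C τ * Polynomial.X + Polynomial.C (β / 2) * Polynomial.X ^ 2)
      (fun j => shortWave c (σ + c ^ 2 / 4) (Φ j)) (longWave c Ψ) where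
  smooth_short j := contDiff_shortWave c _ (hΦ j)
  smooth_long := by
    have h : ContDiff ℝ ∞ fun q : ℝ × ℝ => q.1 - c * q.2 := by fun_prop
    exact hΨ.comp h
  short_eq j x t := by
    have d1 : deriv (fun y => shortWave c (σ + c ^ 2 / 4) (Φ j) y t) = fun y =>
        Complex.I * c / 2 * shortWave c (σ + c ^ 2 / 4) (Φ j) y t +
        shortWave c (σ + c ^ 2 / 4) (Φ₁ j) y t :=
      funext fun y => (hasDerivAt_shortWave_left c _ (h.short j) y t).deriv
    have d2 := ((hasDerivAt_shortWave_left c (σ + c ^ 2 / 4) (h.short j) x t).const_mul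
      (Complex.I * c / 2)).add (hasDerivAt_shortWave_left c (σ + c ^ 2 / 4) (h.short' j) x t)
    have e : shortWave c (σ + c ^ 2 / 4) (fun x => σ * Φ j x - α j * Φ j x * Ψ x) x t =
        (σ - α j * longWave c Ψ x t) * shortWave c (σ + c ^ 2 / 4) (Φ j) x t := by
      simp only [shortWave, longWave]
      push_cast
      ring
    rw [iteratedDeriv_succ, iteratedDeriv_one, d1,
      (hasDerivAt_shortWave_right c _ (h.short j) x t).deriv]
    erw [d2.deriv]
    rw [e]
    push_cast
    linear_combination ((σ : ℂ) * shortWave c (σ + c ^ 2 / 4) (Φ j) x t) * Complex.I_sq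
  long_eq x t := by
    have hx : ∀ {f f' : ℝ → ℝ}, (∀ x, HasDerivAt f (f' x) x) → ∀ y,
        HasDerivAt (fun y => f (y - c * t)) (f' (y - c * t)) y := fun hf y =>
      (hf (y - c * t)).comp_sub_const y (c * t)
    have d1 : deriv (fun y => Ψ (y - c * t)) = fun y => Ψ₁ (y - c * t) :=
      funext fun y => (hx h.long y).deriv
    have d2 : deriv (fun y => Ψ₁ (y - c * t)) = fun y => Ψ₂ (y - c * t) :=
      funext fun y => (hx h.long' y).deriv
    have dt : HasDerivAt (fun s => Ψ (x - c * s)) (Ψ₁ (x - c * t) * -c) t := by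
      refine (h.long (x - c * t)).comp t ?_
      refine (((hasDerivAt_id t).const_mul c).const_sub x).congr_deriv ?_
      simp
    have hsum : HasDerivAt (fun y => ∑ j, α j / 2 * Φ j (y - c * t) ^ 2)
        (∑ j, α j / 2 * (((2 : ℕ) : ℝ) * Φ j (x - c * t) ^ (2 - 1) * Φ₁ j (x - c * t))) x :=
      HasDerivAt.fun_sum fun j _ => ((hx (h.short j) x).pow 2).const_mul (α j / 2)
    have e : (fun y => γ * Ψ₂ (y - c * t) + (τ * Ψ (y - c * t) + β / 2 * Ψ (y - c * t) ^ 2)) =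
        fun y => c * Ψ (y - c * t) - ∑ j, α j / 2 * Φ j (y - c * t) ^ 2 := by
      funext y
      have e' : ∑ j, α j / 2 * Φ j (y - c * t) ^ 2 =
          1 / 2 * ∑ j, α j * Φ j (y - c * t) ^ 2 := by
        rw [Finset.mul_sum]
        exact Finset.sum_congr rfl fun j _ => by ring
      rw [h.eq, e']
      ring
    simp only [longWave, norm_shortWave, sq_abs, Polynomial.eval_add, Polynomial.eval_mul,
      Polynomial.eval_C, Polynomial.eval_X, Polynomial.eval_pow, iteratedDeriv_succ,
      iteratedDeriv_zero, d1, d2]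
    rw [e, dt.deriv, hsum.deriv, (((hx h.long x).const_mul c).fun_sub hsum).deriv]
    ring

end LSI

end SolitaryWaves

/-- Existence of constrained minimizers, and of smooth exponentially decaying solitary waves. -/
theorem theorem2p1 (N : ℕ) (hN : 1 ≤ N) (c σ τ β γ : ℝ) (α : Fin N → ℝ)
    (hc : 0 < c) (hσ : 0 < σ) (hτ : τ < c) (hβ : 0 ≤ β) (hγ : 0 ≤ γ) (hα : ∀ j, 0 < α j)
    (hγβ : 0 < γ ∨ β = 0) (lam : ℝ) (hlam : 0 < lam) :
    (∃ p, LSI.IsMinimizer c σ τ β γ α lam p) ∧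
    ∀ p, LSI.IsMinimizer c σ τ β γ α lam p →
      ∃ κ > 0, ∃ (Φ : Fin N → ℝ → ℝ) (Ψ : ℝ → ℝ),
        (∀ j, Φ j =ᵐ[volume] fun x => κ * p.1 j x) ∧
        (Ψ =ᵐ[volume] fun x => κ * p.2 x) ∧
        ((∃ j, Φ j ≠ 0) ∨ Ψ ≠ 0) ∧
        LSI.SolvesODE c σ τ β γ α Φ Ψ ∧
        (∀ j, MemHInfty (Φ j)) ∧ MemHInfty Ψ ∧
        (∀ j, LSI.ExpDecay (Φ j)) ∧ LSI.ExpDecay Ψ ∧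
        LSI.SolvesLSI γ α (fun j => α j / 2)
          (Polynomial.C τ * Polynomial.X + Polynomial.C (β / 2) * Polynomial.X ^ 2)
          (fun j => LSI.shortWave c (σ + c ^ 2 / 4) (Φ j)) (LSI.longWave c Ψ) := by
  refine ⟨LSI.exists_isMinimizer hN hσ hτ hβ hγ hα hγβ hlam, fun p hp => ?_⟩
  obtain ⟨u, hu1, hu2, hd1, hd2⟩ := LSI.exists_tuple hp.1.1 hp.1.2.1
  have hcub : LSI.cubic β α u = lam := by
    rw [← LSI.integral_density_eq_cubic β α hu1 hu2]
    exact hp.1.2.2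
  have hmin : ∀ v : LSI.Tuple N, LSI.cubic β α v = lam →
      LSI.quad c σ τ γ u ≤ LSI.quad c σ τ γ v := fun v hv => by
    rw [← LSI.energy_eq_quad c σ τ γ hu1 hu2 hd1 hd2, ← LSI.energy_toFun]
    exact hp.2 (LSI.toFun_mem_admissible.2 hv)
  have hEL := LSI.bil_eq_of_isMin hσ hτ hγ hγβ hlam hcub hmin
  have hpos := LSI.quad_pos hσ hτ hγ hγβ hlam hcub
  -- Chosen so that κ/2 is the multiplier K/(3λ).
  obtain ⟨κ, hκ⟩ : ∃ κ, κ = 2 * LSI.quad c σ τ γ u / (3 * lam) := ⟨_, rfl⟩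
  have hκ0 : 0 < κ := by rw [hκ]; positivity
  have hEL' : ∀ h, LSI.bil c σ τ γ u h = κ / 2 * LSI.dcubic β α u h := fun h => by
    rw [hEL h, hκ]; ring
  obtain ⟨Φ₁, Ψ₁, Ψ₂, hcl, hlim⟩ := LSI.exists_isClassical hτ hγ hγβ hEL'
  obtain ⟨hEΦ, hEΨ⟩ := hcl.expDecay hσ hτ hβ hγ hγβ hα hlim
    (fun j => H1.exists_abs_fn_le _) (H1.exists_abs_fn_le _)
  obtain ⟨hsΦ, hsΨ, hHΦ, hHΨ⟩ := hcl.regularity hτ hγ hγβ hEΦ hEΨ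
  refine ⟨κ, hκ0, fun j => (κ • u.1 j).fn, (κ • u.2).fn,
    fun j => (hu1 j).mono fun x hx => by simp only [H1.fn_smul, hx],
    hu2.mono fun x hx => by simp only [H1.fn_smul, hx], Or.inr fun h0 => ?_,
    hcl.solvesODE hsΦ hsΨ, hHΦ, hHΨ, hEΦ, hEΨ, hcl.solvesLSI hsΦ hsΨ⟩
  -- Every term of the density contains a factor of the last component, so Ψ = 0 would make the
  -- constraint value 0 instead of λ.
  have hz : ∀ x, u.2.fn x = 0 := fun x => by
    have := congrFun h0 x
    rw [H1.fn_smul] at this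
    exact (mul_eq_zero.1 this).resolve_left hκ0.ne'
  refine hlam.ne' ?_
  rw [← hcub]
  simp [LSI.cubic, H1.tri, hz]
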